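/- Let $\Theta$ be a Borel subset of a Polish space, $\mu$ a $\sigma$-finite measure on $\mathcal B(\Theta)$, and $\mathbb G$ a stochastic kernel on $\Theta$ such that every $\mathbb G(\ell,\cdot)$, $\ell\in\Theta$, has a density $g(\ell,\cdot)\ge 0$ with respect to $\mu$. For a probability measure $\mu_0$ on $\Theta$, let $\{\vartheta(k)\}_{k\ge 0}$ be the Markov chain with initial distribution $\mu_0$ and transition kernel $\mathbb G$. Let $\mathcal H_\infty^{n\times m}$ be the set of measurable, $\mu$-essentially bounded functions $\Theta\to\mathbb R^{n\times m}$, $\mathcal{SH}_\infty^n$ the set of those in $\mathcal H_\infty^{n\times n}$ with symmetric values, $\mathcal H_\infty^{n+}$ the set of $Q\in\mathcal{SH}_\infty^n$ with $Q(\ell)\ge 0$ $\mu$-a.e., and $\mathcal H_\infty^{n+*}$ the set of $Q\in\mathcal H_\infty^{n+}$ with $Q\gg 0$, where $Q\gg 0$ means that for some $\xi>0$ one has $Q(\ell)\ge\xi I$ for $\mu$-almost all $\ell$. For $Q\in\mathcal H_\infty^{n+}$, $Q^{1/2}$ is the pointwise positive semidefinite square root. For a measurable $A:\Theta\to\mathbb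 R^{n\times n}$, $(A|\mathbb G)$ is called exponentially mean-square stable (EMSS) if there are $\beta\ge 1$ and $\alpha\in(0,1)$ such that for every $x_0\in\mathbb R^n$ and every initial distribution $\mu_0\ll\mu$ the solution of $x(k+1)=A(\vartheta(k))x(k)$, $x(0)=x_0$, satisfies $\mathbf E\|x(k)\|^2\le\beta\alpha^k\|x_0\|^2$ for all $k\ge 0$. Let $A\in\mathcal H_\infty^{n\times n}$ and $G\in\mathcal H_\infty^{n\times m}$. The feedback $u(k)=K(\vartheta(k))x(k)$ exponentially stabilizes $(A,G|\mathbb G)$ if $K\in\mathcal H_\infty^{m\times n}$ and $(A+GK|\mathbb G)$ is EMSS; $(A,G|\mathbb G)$ is exponentially mean-square stabilizable if such a $K$ exists; and for $C\in\mathcal H_\infty^{p\times n}$, $(A;C|\mathbb G)$ is detectable if $(A+HC|\mathbb G)$ is EMSS for some $H\in\mathcal H_\infty^{n\times p}$. Put $\mathcal E(P)(\ell)=\int_\Theta g(\ell,t)P(t)\,\mu(dt)$, $\mathcal T_B(P)(\ell)=B(\ell)^T\mathcal E(P)(\ell)B(\ell)$, $\mathcal G(P)(\ell)=G(\ell)^T\mathcal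 E(P)(\ell)A(\ell)$, $\mathcal R(P)(\ell)=R(\ell)+\mathcal T_G(P)(\ell)$ and $\mathcal M(P)(\ell)=-\mathcal R(P)(\ell)^{-1}\mathcal G(P)(\ell)$. A solution of the coupled algebraic Riccati equations (coupled-AREs) is a $P\in\mathcal{SH}_\infty^n$ such that, for $\mu$-almost all $\ell$, $\mathcal R(P)(\ell)$ is invertible and $$P(\ell)=\mathcal T_A(P)(\ell)+Q(\ell)-\mathcal G(P)(\ell)^T\mathcal R(P)(\ell)^{-1}\mathcal G(P)(\ell).$$ It is a stabilizing solution if the feedback $u(k)=\mathcal M(P)(\vartheta(k))x(k)$ exponentially stabilizes $(A,G|\mathbb G)$. The sign condition is $\mathcal R(P)\gg 0$. **Corollary.** Let $Q\in\mathcal H_\infty^{n+}$ and $R\in\mathcal H_\infty^{m+*}$. Suppose that $(A,G|\mathbb G)$ is exponentially mean-square stabilizable and $(A;Q^{1/2}|\mathbb G)$ is detectable. Then the coupled-AREs have a stabilizing solution $P$ that satisfies the sign condition, and it is unique: every stabilizing solution of the coupled-AREs (whether or not it is assumed to satisfy the sign condition) equals $P$ $\mu$-almost everywhere. -/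

import Mathlib

open MeasureTheory ProbabilityTheory Filter

namespace MJLS

open scoped ENNReal Matrix MatrixOrder Matrix.Norms.L2Operator

/-! ### Spaces of matrix-valued functions on the mode space -/

section Spaces

variable {Θ : Type*} [MeasurableSpace Θ]

/-- `Q ∈ 𝓗_∞^{n×m}`: measurable and essentially bounded in the operator norm that is induced by
the Euclidean norms. -/
def MemH {n m : ℕ} (μ : Measure Θ) (Q : Θ → Matrix (Fin n) (Fin m) ℝ) : Prop :=
  (∀ i j, Measurable fun ℓ => Q ℓ i j) ∧ ∃ c : ℝ, ∀ᵐ ℓ ∂μ, ‖Q ℓ‖ ≤ c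

/-- `Q ∈ 𝓢𝓗_∞^n`: an element of `𝓗_∞^{n×n}` with symmetric values. -/
def MemSH {n : ℕ} (μ : Measure Θ) (Q : Θ → Matrix (Fin n) (Fin n) ℝ) : Prop :=
  MemH μ Q ∧ ∀ ℓ, (Q ℓ).IsSymm

/-- `Q ∈ 𝓗_∞^{n+}`: an element of `𝓢𝓗_∞^n` that is positive semidefinite `μ`-a.e. -/
def MemHPos {n : ℕ} (μ : Measure Θ) (Q : Θ → Matrix (Fin n) (Fin n) ℝ) : Prop :=
  MemSH μ Q ∧ ∀ᵐ ℓ ∂μ, (Q ℓ).PosSemidef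

/-- `Q ≫ 0` `μ`-a.e.: there is one `ξ > 0` with `Q(ℓ) ≥ ξ I` for `μ`-almost all `ℓ`. -/
def UniformlyPos {n : ℕ} (μ : Measure Θ) (Q : Θ → Matrix (Fin n) (Fin n) ℝ) : Prop :=
  ∃ ξ : ℝ, 0 < ξ ∧ ∀ᵐ ℓ ∂μ, (Q ℓ - ξ • (1 : Matrix (Fin n) (Fin n) ℝ)).PosSemidef

/-- `Q ∈ 𝓗_∞^{n+*}`: an element of `𝓗_∞^{n+}` with `Q ≫ 0`. -/
def MemHPosStar {n : ℕ} (μ : Measure Θ) (Q : Θ → Matrix (Fin n) (Fin n) ℝ) : Prop :=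
  MemHPos μ Q ∧ UniformlyPos μ Q

/-- `Q^{1/2}`, the pointwise positive semidefinite square root. -/
noncomputable def sqrtFun {n : ℕ} (Q : Θ → Matrix (Fin n) (Fin n) ℝ) :
    Θ → Matrix (Fin n) (Fin n) ℝ :=
  fun ℓ => CFC.sqrt (Q ℓ)

end Spaces

/-! ### The Markov chain, stability, stabilizability, detectability -/

section Stability

variable {Θ : Type*} [MeasurableSpace Θ]

/-- The law on `Θ^ℕ` of the Markov chain with initial distribution `μ₀` and transition kernel `𝔾`:
the next mode, given all modes up to time `k`, has distribution `𝔾(ϑ(k), ·)`. The chain itself is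
the coordinate process under this law. -/
noncomputable def chainLaw (𝔾 : Kernel Θ Θ) [IsMarkovKernel 𝔾] (μ₀ : Measure Θ) :
    Measure (ℕ → Θ) :=
  Kernel.trajMeasure (X := fun _ : ℕ => Θ) μ₀ fun k =>
    𝔾.comap (fun h : (i : Finset.Iic k) → Θ => h ⟨k, Finset.mem_Iic.2 le_rfl⟩)
      (measurable_pi_apply _)

/-- The state of `x(k+1) = A(ϑ(k)) x(k)`, `x(0) = x₀`, along the mode trajectory `ϑ`. -/
noncomputable def state {n : ℕ} (A : Θ → Matrix (Fin n) (Fin n) ℝ)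
    (x₀ : EuclideanSpace ℝ (Fin n)) (ϑ : ℕ → Θ) : ℕ → EuclideanSpace ℝ (Fin n)
  | 0 => x₀
  | k + 1 => WithLp.toLp 2 (A (ϑ k) *ᵥ (state A x₀ ϑ k).ofLp)

/-- `(A|𝔾)` is exponentially mean-square stable: `E‖x(k)‖² ≤ β α^k ‖x₀‖²` with constants that do
not depend on the initial state `x₀` or on the initial distribution `μ₀ ≪ μ` of the modes. -/
def EMSS {n : ℕ} (μ : Measure Θ) (𝔾 : Kernel Θ Θ) [IsMarkovKernel 𝔾]
    (A : Θ → Matrix (Fin n) (Fin n) ℝ) : Prop :=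
  ∃ β α : ℝ, 1 ≤ β ∧ 0 < α ∧ α < 1 ∧
    ∀ (x₀ : EuclideanSpace ℝ (Fin n)) (μ₀ : Measure Θ), IsProbabilityMeasure μ₀ → μ₀ ≪ μ →
      ∀ k : ℕ, ∫⁻ ϑ, ENNReal.ofReal (‖state A x₀ ϑ k‖ ^ 2) ∂(chainLaw 𝔾 μ₀) ≤
        ENNReal.ofReal (β * α ^ k * ‖x₀‖ ^ 2)

/-- The feedback `u(k) = K(ϑ(k)) x(k)` exponentially stabilizes `(A, G|𝔾)`. -/
def Stabilizes {n m : ℕ} (μ : Measure Θ) (𝔾 : Kernel Θ Θ) [IsMarkovKernel 𝔾]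
    (A : Θ → Matrix (Fin n) (Fin n) ℝ) (G : Θ → Matrix (Fin n) (Fin m) ℝ)
    (K : Θ → Matrix (Fin m) (Fin n) ℝ) : Prop :=
  MemH μ K ∧ EMSS μ 𝔾 fun ℓ => A ℓ + G ℓ * K ℓ

/-- `(A, G|𝔾)` is exponentially mean-square stabilizable. -/
def Stabilizable {n m : ℕ} (μ : Measure Θ) (𝔾 : Kernel Θ Θ) [IsMarkovKernel 𝔾]
    (A : Θ → Matrix (Fin n) (Fin n) ℝ) (G : Θ → Matrix (Fin n) (Fin m) ℝ) : Prop :=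
  ∃ K : Θ → Matrix (Fin m) (Fin n) ℝ, Stabilizes μ 𝔾 A G K

/-- `(A; C|𝔾)` is detectable. -/
def Detectable {n p : ℕ} (μ : Measure Θ) (𝔾 : Kernel Θ Θ) [IsMarkovKernel 𝔾]
    (A : Θ → Matrix (Fin n) (Fin n) ℝ) (C : Θ → Matrix (Fin p) (Fin n) ℝ) : Prop :=
  ∃ H : Θ → Matrix (Fin n) (Fin p) ℝ, MemH μ H ∧ EMSS μ 𝔾 fun ℓ => A ℓ + H ℓ * C ℓ

end Stability

/-! ### The coupled algebraic Riccati equations -/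

section Riccati

variable {Θ : Type*} [MeasurableSpace Θ] {n m : ℕ}

/-- `𝓔(U)(ℓ) = ∫ g(ℓ,t) U(t) μ(dt)`, entry by entry. -/
noncomputable def opE (μ : Measure Θ) (g : Θ → Θ → ℝ) (U : Θ → Matrix (Fin n) (Fin n) ℝ) :
    Θ → Matrix (Fin n) (Fin n) ℝ :=
  fun ℓ => Matrix.of fun i j => ∫ t, g ℓ t * U t i j ∂μ

/-- `𝓣_B(U)(ℓ) = B(ℓ)ᵀ 𝓔(U)(ℓ) B(ℓ)`. -/
noncomputable def opT (μ : Measure Θ) (g : Θ → Θ → ℝ) (B : Θ → Matrix (Fin n) (Fin m) ℝ)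
    (U : Θ → Matrix (Fin n) (Fin n) ℝ) : Θ → Matrix (Fin m) (Fin m) ℝ :=
  fun ℓ => (B ℓ)ᵀ * opE μ g U ℓ * B ℓ

/-- `𝓖(P)(ℓ) = G(ℓ)ᵀ 𝓔(P)(ℓ) A(ℓ)`. -/
noncomputable def opG (μ : Measure Θ) (g : Θ → Θ → ℝ) (A : Θ → Matrix (Fin n) (Fin n) ℝ)
    (G : Θ → Matrix (Fin n) (Fin m) ℝ) (P : Θ → Matrix (Fin n) (Fin n) ℝ) :
    Θ → Matrix (Fin m) (Fin n) ℝ :=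
  fun ℓ => (G ℓ)ᵀ * opE μ g P ℓ * A ℓ

/-- `𝓡(P)(ℓ) = R(ℓ) + 𝓣_G(P)(ℓ)`. -/
noncomputable def opR (μ : Measure Θ) (g : Θ → Θ → ℝ) (G : Θ → Matrix (Fin n) (Fin m) ℝ)
    (R : Θ → Matrix (Fin m) (Fin m) ℝ) (P : Θ → Matrix (Fin n) (Fin n) ℝ) :
    Θ → Matrix (Fin m) (Fin m) ℝ :=
  fun ℓ => R ℓ + opT μ g G P ℓ

/-- `𝓜(P)(ℓ) = -𝓡(P)(ℓ)⁻¹ 𝓖(P)(ℓ)`. -/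
noncomputable def opM (μ : Measure Θ) (g : Θ → Θ → ℝ) (A : Θ → Matrix (Fin n) (Fin n) ℝ)
    (G : Θ → Matrix (Fin n) (Fin m) ℝ) (R : Θ → Matrix (Fin m) (Fin m) ℝ)
    (P : Θ → Matrix (Fin n) (Fin n) ℝ) : Θ → Matrix (Fin m) (Fin n) ℝ :=
  fun ℓ => -((opR μ g G R P ℓ)⁻¹ * opG μ g A G P ℓ)

/-- `P` solves the coupled algebraic Riccati equations
`P = 𝓣_A(P) + Q - 𝓖(P)ᵀ 𝓡(P)⁻¹ 𝓖(P)` `μ`-a.e.; the inverse has to exist for `μ`-almost all `ℓ`. -/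
def IsSolution (μ : Measure Θ) (g : Θ → Θ → ℝ) (A : Θ → Matrix (Fin n) (Fin n) ℝ)
    (G : Θ → Matrix (Fin n) (Fin m) ℝ) (Q : Θ → Matrix (Fin n) (Fin n) ℝ)
    (R : Θ → Matrix (Fin m) (Fin m) ℝ) (P : Θ → Matrix (Fin n) (Fin n) ℝ) : Prop :=
  MemSH μ P ∧ ∀ᵐ ℓ ∂μ, IsUnit (opR μ g G R P ℓ) ∧
    P ℓ = opT μ g A P ℓ + Q ℓ
      - (opG μ g A G P ℓ)ᵀ * (opR μ g G R P ℓ)⁻¹ * opG μ g A G P ℓ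

/-- The sign condition `𝓡(P) ≫ 0` `μ`-a.e. -/
def SignCondition (μ : Measure Θ) (g : Θ → Θ → ℝ) (G : Θ → Matrix (Fin n) (Fin m) ℝ)
    (R : Θ → Matrix (Fin m) (Fin m) ℝ) (P : Θ → Matrix (Fin n) (Fin n) ℝ) : Prop :=
  UniformlyPos μ (opR μ g G R P)

/-- `P` is a stabilizing solution of the coupled algebraic Riccati equations: the feedback
`u(k) = 𝓜(P)(ϑ(k)) x(k)` exponentially stabilizes `(A, G|𝔾)`. -/
def IsStabilizingSolution (μ : Measure Θ) (𝔾 : Kernel Θ Θ) [IsMarkovKernel 𝔾] (g : Θ → Θ → ℝ)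
    (A : Θ → Matrix (Fin n) (Fin n) ℝ) (G : Θ → Matrix (Fin n) (Fin m) ℝ)
    (Q : Θ → Matrix (Fin n) (Fin n) ℝ) (R : Θ → Matrix (Fin m) (Fin m) ℝ)
    (P : Θ → Matrix (Fin n) (Fin n) ℝ) : Prop :=
  IsSolution μ g A G Q R P ∧ Stabilizes μ 𝔾 A G (opM μ g A G R P)

end Riccati

end MJLS

namespace MJLS

open scoped ENNReal Matrix MatrixOrder Matrix.Norms.L2Operator

/-! ### Real matrices in the Loewner order -/

section RealMatrix

variable {n m p : ℕ}

/-! Write `T_F(U) = Fᵀ 𝓔(U) F`. One step of the closed loop turns the expectation of a quadratic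
form with weight `U` into one with weight `T_F(U)` (`lintegral_quadForm_state`). Hence mean-square
stability of `F` is a statement about the iterates `T_F^k(I)`. It is equivalent to a bounded `Z ≥ I`
with `T_F(Z) ≤ ρ Z` for some `ρ < 1` (`EMSS.exists_isLyapunov`, `IsLyapunov.emss`). After this
translation the argument takes place in the Loewner order, almost everywhere.

Completion of squares (`riccati_completion`) says that for every gain `K`, `T_{A+GK}(P) + Q + KᵀRK`
is the Riccati operator at `P` plus a square weighted by `𝓡(P)`. On nonnegative arguments the
operator is therefore a minimum over gains, and monotone.

Existence: the iterates from zero increase. The cost of a stabilizing gain bounds them by a multiple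
of its Lyapunov function, so they converge to a solution `P ≥ 0`, for which `𝓡(P) ≥ R ≫ 0`.

Stability: the closed loop of `P` is the stable `A + H Q^{1/2}` plus a perturbation controlled by
the running cost. Adding a large multiple of `P` to a Lyapunov function of `A + H Q^{1/2}` absorbs
that perturbation (`emss_of_detectable`).

Uniqueness: when `F` is stable, `T_F(D) ≤ D` forces `D ≥ 0` (`IsLyapunov.nonneg_of_lyap_le`). This
makes every stabilizing solution nonnegative, with no sign condition assumed, and then orders any
two of them both ways. -/

theorem nonneg_iff_quadForm {U : Matrix (Fin n) (Fin n) ℝ} :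
    0 ≤ U ↔ U.IsSymm ∧ ∀ x : Fin n → ℝ, 0 ≤ x ⬝ᵥ U *ᵥ x := by
  rw [Matrix.nonneg_iff_posSemidef, Matrix.posSemidef_iff_dotProduct_mulVec]
  simp [Matrix.IsHermitian, Matrix.IsSymm, Matrix.conjTranspose_eq_transpose_of_trivial]

theorem le_iff_quadForm {U V : Matrix (Fin n) (Fin n) ℝ} (hU : U.IsSymm) (hV : V.IsSymm) :
    U ≤ V ↔ ∀ x : Fin n → ℝ, x ⬝ᵥ U *ᵥ x ≤ x ⬝ᵥ V *ᵥ x := by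
  rw [← sub_nonneg, nonneg_iff_quadForm]
  simp [hV.sub hU, Matrix.sub_mulVec, dotProduct_sub]

theorem quadForm_mono {U V : Matrix (Fin n) (Fin n) ℝ} (h : U ≤ V) (x : Fin n → ℝ) :
    x ⬝ᵥ U *ᵥ x ≤ x ⬝ᵥ V *ᵥ x := by
  rw [← sub_nonneg, nonneg_iff_quadForm] at h
  have := h.2 x
  simp only [Matrix.sub_mulVec, dotProduct_sub] at this
  linarith

theorem isSymm_of_nonneg {U : Matrix (Fin n) (Fin n) ℝ} (h : 0 ≤ U) : U.IsSymm :=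
  (nonneg_iff_quadForm.1 h).1

theorem isSymm_conj {X : Matrix (Fin n) (Fin n) ℝ} (hX : X.IsSymm)
    (B : Matrix (Fin n) (Fin m) ℝ) : (Bᵀ * X * B).IsSymm := by
  simp [Matrix.IsSymm, Matrix.transpose_mul, hX.eq, Matrix.mul_assoc]

theorem conj_nonneg {X : Matrix (Fin n) (Fin n) ℝ} (hX : 0 ≤ X)
    (B : Matrix (Fin n) (Fin m) ℝ) : 0 ≤ Bᵀ * X * B := by
  have := (Matrix.nonneg_iff_posSemidef.1 hX).conjTranspose_mul_mul_same B
  rwa [Matrix.conjTranspose_eq_transpose_of_trivial, ← Matrix.nonneg_iff_posSemidef] at this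

theorem conj_mono {X Y : Matrix (Fin n) (Fin n) ℝ} (h : X ≤ Y)
    (B : Matrix (Fin n) (Fin m) ℝ) : Bᵀ * X * B ≤ Bᵀ * Y * B := by
  have := conj_nonneg (sub_nonneg.2 h) B
  rwa [Matrix.mul_sub, Matrix.sub_mul, sub_nonneg] at this

theorem smul_le_smul_matrix {X Y : Matrix (Fin n) (Fin n) ℝ} {c : ℝ} (hc : 0 ≤ c) (h : X ≤ Y) :
    c • X ≤ c • Y := by
  rw [← sub_nonneg, ← smul_sub, Matrix.nonneg_iff_posSemidef]
  exact (Matrix.nonneg_iff_posSemidef.1 (sub_nonneg.2 h)).smul hc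

theorem smul_le_smul_of_le {X : Matrix (Fin n) (Fin n) ℝ} {c d : ℝ} (hX : 0 ≤ X) (h : c ≤ d) :
    c • X ≤ d • X := by
  rw [← sub_nonneg, ← sub_smul, Matrix.nonneg_iff_posSemidef]
  exact (Matrix.nonneg_iff_posSemidef.1 hX).smul (sub_nonneg.2 h)

theorem one_nonneg_matrix : (0 : Matrix (Fin n) (Fin n) ℝ) ≤ 1 :=
  Matrix.nonneg_iff_posSemidef.2 Matrix.PosSemidef.one

theorem transpose_mul_self_nonneg (B : Matrix (Fin n) (Fin m) ℝ) : 0 ≤ Bᵀ * B := by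
  simpa using conj_nonneg one_nonneg_matrix B

theorem quadForm_conj (X : Matrix (Fin n) (Fin n) ℝ) (B : Matrix (Fin n) (Fin m) ℝ)
    (x : Fin m → ℝ) : x ⬝ᵥ (Bᵀ * X * B) *ᵥ x = (B *ᵥ x) ⬝ᵥ X *ᵥ (B *ᵥ x) := by
  rw [← Matrix.mulVec_mulVec, ← Matrix.mulVec_mulVec, Matrix.dotProduct_mulVec,
    Matrix.vecMul_transpose]

theorem dotProduct_self_eq_norm_sq (x : EuclideanSpace ℝ (Fin n)) :
    x.ofLp ⬝ᵥ x.ofLp = ‖x‖ ^ 2 := by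
  rw [EuclideanSpace.real_norm_sq_eq]
  simp [dotProduct, sq]

theorem le_smul_one_of_norm_le {U : Matrix (Fin n) (Fin n) ℝ} {c : ℝ} (hU : U.IsSymm)
    (h : ‖U‖ ≤ c) : U ≤ c • 1 := by
  rw [le_iff_quadForm hU (by simp [Matrix.IsSymm])]
  intro x
  have h1 := Matrix.l2_opNorm_mulVec U (WithLp.toLp 2 x)
  have h2 := real_inner_le_norm (WithLp.toLp 2 x) (WithLp.toLp 2 (U *ᵥ x))
  have h3 : inner ℝ (WithLp.toLp 2 x) (WithLp.toLp 2 (U *ᵥ x)) = x ⬝ᵥ U *ᵥ x := by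
    simp [PiLp.inner_apply, dotProduct, mul_comm]
  have h4 := dotProduct_self_eq_norm_sq (WithLp.toLp 2 x)
  simp only [Matrix.smul_mulVec, Matrix.one_mulVec, dotProduct_smul, smul_eq_mul]
  simp only at h4
  rw [h3] at h2
  rw [h4]
  simp only at h1
  have := norm_nonneg (WithLp.toLp 2 x)
  calc _ ≤ _ := h2
    _ ≤ ‖WithLp.toLp 2 x‖ * (‖U‖ * ‖WithLp.toLp 2 x‖) := by gcongr; exact h1
    _ ≤ ‖WithLp.toLp 2 x‖ * (c * ‖WithLp.toLp 2 x‖) := by gcongr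
    _ = _ := by ring

theorem abs_apply_le_norm (U : Matrix (Fin n) (Fin m) ℝ) (i : Fin n) (j : Fin m) :
    |U i j| ≤ ‖U‖ := by
  have h1 := Matrix.l2_opNorm_mulVec U (EuclideanSpace.single j 1)
  have h2 := PiLp.norm_apply_le (WithLp.toLp 2 (U *ᵥ (EuclideanSpace.single j (1 : ℝ)).ofLp)) i
  simp at h1 h2
  linarith

theorem exists_norm_le_of_abs_apply_le (n m : ℕ) : ∃ K : ℝ, 0 ≤ K ∧
    ∀ (U : Matrix (Fin n) (Fin m) ℝ) (c : ℝ), (∀ i j, |U i j| ≤ c) → ‖U‖ ≤ K * c := by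
  refine ⟨∑ i : Fin n, ∑ j : Fin m, ‖Matrix.single i j (1 : ℝ)‖, by positivity, fun U c h => ?_⟩
  conv_lhs => rw [Matrix.matrix_eq_sum_single U]
  refine (norm_sum_le _ _).trans ?_
  rw [Finset.sum_mul]
  refine Finset.sum_le_sum fun i _ => (norm_sum_le _ _).trans ?_
  rw [Finset.sum_mul]
  refine Finset.sum_le_sum fun j _ => ?_
  have : Matrix.single i j (U i j) = U i j • Matrix.single i j (1 : ℝ) := by simp
  rw [this, norm_smul, mul_comm, Real.norm_eq_abs]
  gcongr
  exact h i j

/-- Polarization: with `s = ±1` these test vectors recover or bound the off-diagonal entries. -/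
theorem quadForm_single_add_smul_single {U : Matrix (Fin n) (Fin n) ℝ} (hU : U.IsSymm)
    (i j : Fin n) (s : ℝ) :
    (Pi.single i 1 + s • Pi.single j 1) ⬝ᵥ U *ᵥ (Pi.single i 1 + s • Pi.single j 1) =
      U i i + 2 * s * U i j + s ^ 2 * U j j := by
  have : U j i = U i j := hU.apply i j
  simp [Matrix.mulVec_add, Matrix.mulVec_smul, add_dotProduct, this]
  ring

theorem quadForm_single (U : Matrix (Fin n) (Fin n) ℝ) (i : Fin n) :
    (Pi.single i 1) ⬝ᵥ U *ᵥ (Pi.single i 1) = U i i := by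
  simp

theorem abs_apply_le_of_le_smul_one {U : Matrix (Fin n) (Fin n) ℝ} {c : ℝ} (h0 : 0 ≤ U)
    (h : U ≤ c • 1) (i j : Fin n) : |U i j| ≤ c := by
  have hU := isSymm_of_nonneg h0
  have hd : ∀ k, U k k ≤ c := fun k => by
    have := quadForm_mono h (Pi.single k 1)
    rw [quadForm_single, quadForm_single] at this
    simpa using this
  have h1 := (nonneg_iff_quadForm.1 h0).2 (Pi.single i 1 + (1 : ℝ) • Pi.single j 1)
  have h2 := (nonneg_iff_quadForm.1 h0).2 (Pi.single i 1 + (-1 : ℝ) • Pi.single j 1)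
  rw [quadForm_single_add_smul_single hU] at h1 h2
  have := hd i
  have := hd j
  rw [abs_le]
  constructor <;> linarith

/-- Nonnegativity at `e_i ± e_j` bounds the off-diagonal entries by the diagonal ones. Only the `n`
basis vectors have to be tested, at the price of a factor `n`. -/
theorem le_smul_one_of_apply_self_le {U : Matrix (Fin n) (Fin n) ℝ} {c : ℝ} (h0 : 0 ≤ U)
    (h : ∀ i, U i i ≤ c) : U ≤ (n * c) • 1 := by
  have hU := isSymm_of_nonneg h0
  have hoff : ∀ i j, |U i j| ≤ c := fun i j => by
    have h1 := (nonneg_iff_quadForm.1 h0).2 (Pi.single i 1 + (1 : ℝ) • Pi.single j 1)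
    have h2 := (nonneg_iff_quadForm.1 h0).2 (Pi.single i 1 + (-1 : ℝ) • Pi.single j 1)
    rw [quadForm_single_add_smul_single hU] at h1 h2
    have := h i
    have := h j
    rw [abs_le]
    constructor <;> linarith
  rw [le_iff_quadForm hU (by simp [Matrix.IsSymm])]
  intro x
  have : ∀ i j, x i * (U i j * x j) ≤ c * ((x i ^ 2 + x j ^ 2) / 2) := fun i j => by
    have hc : 0 ≤ c := (abs_nonneg _).trans (hoff i j)
    calc x i * (U i j * x j) ≤ |x i * (U i j * x j)| := le_abs_self _
      _ = |U i j| * (|x i| * |x j|) := by rw [abs_mul, abs_mul]; ring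
      _ ≤ c * ((x i ^ 2 + x j ^ 2) / 2) := by
        gcongr
        · exact hoff i j
        · have := sq_nonneg (|x i| - |x j|)
          rw [← sq_abs (x i), ← sq_abs (x j)]
          linarith
  calc x ⬝ᵥ U *ᵥ x = ∑ i, ∑ j, x i * (U i j * x j) := by
        simp [dotProduct, Matrix.mulVec, Finset.mul_sum]
    _ ≤ ∑ i, ∑ j, c * ((x i ^ 2 + x j ^ 2) / 2) :=
        Finset.sum_le_sum fun i _ => Finset.sum_le_sum fun j _ => this i j
    _ = _ := by
        rw [Matrix.smul_mulVec, Matrix.one_mulVec, dotProduct_smul]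
        simp only [smul_eq_mul, dotProduct, ← Finset.mul_sum, ← Finset.sum_div,
          Finset.sum_add_distrib, Finset.sum_const, Finset.card_univ, Fintype.card_fin,
          nsmul_eq_mul]
        simp only [← sq]
        ring

theorem transpose_mul_self_le {B : Matrix (Fin n) (Fin m) ℝ} {c : ℝ} (h : ‖B‖ ≤ c) :
    Bᵀ * B ≤ c ^ 2 • 1 := by
  refine le_smul_one_of_norm_le (by simp [Matrix.IsSymm]) ?_
  rw [← Matrix.conjTranspose_eq_transpose_of_trivial, Matrix.l2_opNorm_conjTranspose_mul_self, sq]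
  have := (norm_nonneg B).trans h
  gcongr

/-- Matrix form of Young's inequality: expand the nonnegative square of `a S - a⁻¹ W` weighted by
`X`. -/
theorem conj_add_le {X : Matrix (Fin n) (Fin n) ℝ} (hX : 0 ≤ X) {a : ℝ} (ha : a ≠ 0)
    (S W : Matrix (Fin n) (Fin m) ℝ) :
    (S + W)ᵀ * X * (S + W) ≤ (1 + a ^ 2) • (Sᵀ * X * S) + (1 + (a⁻¹) ^ 2) • (Wᵀ * X * W) := by
  have h := conj_nonneg hX (a • S - a⁻¹ • W)
  rw [← sub_nonneg]
  convert h using 1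
  have : a * a⁻¹ = 1 := mul_inv_cancel₀ ha
  have h' : a⁻¹ * a = 1 := inv_mul_cancel₀ ha
  simp only [Matrix.transpose_sub, Matrix.transpose_add, Matrix.transpose_smul, Matrix.sub_mul,
    Matrix.mul_sub, Matrix.add_mul, Matrix.mul_add, Matrix.smul_mul, Matrix.mul_smul, smul_sub,
    smul_smul, this, h', one_smul, add_smul, sq]
  abel

/-- Completion of squares in the Riccati operator. -/
theorem riccati_completion {X : Matrix (Fin n) (Fin n) ℝ} (hX : X.IsSymm)
    {R : Matrix (Fin m) (Fin m) ℝ} (hR : R.IsSymm) (A : Matrix (Fin n) (Fin n) ℝ)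
    (G : Matrix (Fin n) (Fin m) ℝ) (hu : IsUnit (R + Gᵀ * X * G)) (K : Matrix (Fin m) (Fin n) ℝ) :
    (A + G * K)ᵀ * X * (A + G * K) + Kᵀ * R * K =
      Aᵀ * X * A - (Gᵀ * X * A)ᵀ * (R + Gᵀ * X * G)⁻¹ * (Gᵀ * X * A) +
        (K - -((R + Gᵀ * X * G)⁻¹ * (Gᵀ * X * A)))ᵀ * (R + Gᵀ * X * G) *
          (K - -((R + Gᵀ * X * G)⁻¹ * (Gᵀ * X * A))) := by
  set S := R + Gᵀ * X * G with hS
  set L := Gᵀ * X * A with hL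
  have hSs : S.IsSymm := hR.add (isSymm_conj hX G)
  have hdet : IsUnit S.det := (Matrix.isUnit_iff_isUnit_det _).1 hu
  have h1 : S * S⁻¹ = 1 := Matrix.mul_nonsing_inv _ hdet
  have h2 : S⁻¹ * S = 1 := Matrix.nonsing_inv_mul _ hdet
  have hSi : (S⁻¹)ᵀ = S⁻¹ := by rw [Matrix.transpose_nonsing_inv, hSs.eq]
  -- Substituting `R = S - GᵀXG` makes the terms `KᵀGᵀXGK` cancel against those in `e2`.
  have e1 : Kᵀ * R * K = Kᵀ * S * K - Kᵀ * Gᵀ * X * G * K := by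
    rw [hS]; simp only [Matrix.mul_add, Matrix.add_mul, Matrix.mul_assoc]; abel
  have e2 : (A + G * K)ᵀ * X * (A + G * K) =
      Aᵀ * X * A + Lᵀ * K + Kᵀ * L + Kᵀ * Gᵀ * X * G * K := by
    rw [hL]
    simp only [Matrix.mul_add, Matrix.add_mul, Matrix.mul_assoc, Matrix.transpose_add,
      Matrix.transpose_mul, Matrix.transpose_transpose, hX.eq]
    abel
  have e3 : (K - -(S⁻¹ * L))ᵀ * S * (K - -(S⁻¹ * L)) =
      Kᵀ * S * K + Kᵀ * (S * S⁻¹) * L + Lᵀ * (S⁻¹ * S) * K + Lᵀ * S⁻¹ * (S * S⁻¹) * L := by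
    simp only [sub_neg_eq_add, Matrix.mul_add, Matrix.add_mul, Matrix.mul_assoc,
      Matrix.transpose_add, Matrix.transpose_mul, hSi]
    abel
  rw [e1, e2, e3, h1, h2]
  simp only [Matrix.mul_one]
  abel

theorem isUnit_of_smul_one_le {S : Matrix (Fin n) (Fin n) ℝ} {ξ : ℝ} (hξ : 0 < ξ)
    (h : ξ • 1 ≤ S) : IsUnit S := by
  have h1 : (ξ • (1 : Matrix (Fin n) (Fin n) ℝ)).PosDef := Matrix.PosDef.one.smul hξ
  have h2 := h1.add_posSemidef (Matrix.le_iff.1 h)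
  rw [add_sub_cancel] at h2
  exact h2.isUnit

theorem continuousOn_sqrt :
    ContinuousOn (CFC.sqrt : Matrix (Fin n) (Fin n) ℝ → _) {a | 0 ≤ a} := by
  have := ContinuousOn.cfcₙ_nnreal_of_mem_nhdsSet (X := Matrix (Fin n) (Fin n) ℝ)
    (A := Matrix (Fin n) (Fin n) ℝ) (s := Set.univ) (a := id) (t := {a | 0 ≤ a}) NNReal.sqrt
    Filter.univ_mem continuousOn_id (fun x hx => hx) NNReal.continuous_sqrt.continuousOn
    (by simp)
  exact this

theorem isClosed_nonneg : IsClosed {a : Matrix (Fin n) (Fin n) ℝ | 0 ≤ a} := by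
  have : {a : Matrix (Fin n) (Fin n) ℝ | 0 ≤ a} =
      {a | aᵀ = a} ∩ ⋂ x : Fin n → ℝ, {a | 0 ≤ x ⬝ᵥ a *ᵥ x} := by
    ext a
    simp [nonneg_iff_quadForm, Matrix.IsSymm]
  rw [this]
  refine (isClosed_eq (by fun_prop) (by fun_prop)).inter (isClosed_iInter fun x => ?_)
  exact isClosed_le continuous_const (by fun_prop)

end RealMatrix

/-! ### Essentially bounded matrix functions and averaging along a kernel -/

section MemH

variable {Θ : Type*} [MeasurableSpace Θ] {μ : Measure Θ} {n m p : ℕ}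

theorem MemH.abs_apply_le {U : Θ → Matrix (Fin n) (Fin m) ℝ} (h : MemH μ U) :
    ∃ c : ℝ, 0 ≤ c ∧ ∀ᵐ ℓ ∂μ, ∀ i j, |U ℓ i j| ≤ c := by
  obtain ⟨c, hc⟩ := h.2
  refine ⟨max c 0, le_max_right _ _, ?_⟩
  filter_upwards [hc] with ℓ hℓ i j
  exact (abs_apply_le_norm _ i j).trans (hℓ.trans (le_max_left _ _))

theorem MemH.exists_norm_le {U : Θ → Matrix (Fin n) (Fin m) ℝ} (h : MemH μ U) :
    ∃ c : ℝ, 0 < c ∧ ∀ᵐ ℓ ∂μ, ‖U ℓ‖ ≤ c := by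
  obtain ⟨c, hc⟩ := h.2
  refine ⟨max c 1, by positivity, ?_⟩
  filter_upwards [hc] with ℓ hℓ
  exact hℓ.trans (le_max_left _ _)

theorem memH_of_abs_apply_le {U : Θ → Matrix (Fin n) (Fin m) ℝ}
    (hm : ∀ i j, Measurable fun ℓ => U ℓ i j) {c : ℝ} (h : ∀ᵐ ℓ ∂μ, ∀ i j, |U ℓ i j| ≤ c) :
    MemH μ U := by
  obtain ⟨K, -, hK⟩ := exists_norm_le_of_abs_apply_le n m
  exact ⟨hm, K * c, h.mono fun ℓ hℓ => hK _ _ hℓ⟩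

theorem measurable_mul_apply {U : Θ → Matrix (Fin n) (Fin m) ℝ} {V : Θ → Matrix (Fin m) (Fin p) ℝ}
    (hU : ∀ i j, Measurable fun ℓ => U ℓ i j) (hV : ∀ i j, Measurable fun ℓ => V ℓ i j)
    (i : Fin n) (j : Fin p) : Measurable fun ℓ => (U ℓ * V ℓ) i j := by
  simp only [Matrix.mul_apply]
  exact Finset.measurable_sum _ fun k _ => (hU i k).mul (hV k j)

/-- Cramer's rule expresses the inverse through determinants; it also covers the default value at
singular matrices, so no invertibility is needed. -/
theorem measurable_inv_apply {U : Θ → Matrix (Fin n) (Fin n) ℝ}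
    (hU : ∀ i j, Measurable fun ℓ => U ℓ i j) (i j : Fin n) :
    Measurable fun ℓ => (U ℓ)⁻¹ i j := by
  have hdet : ∀ {k : ℕ} {V : Θ → Matrix (Fin k) (Fin k) ℝ},
      (∀ i j, Measurable fun ℓ => V ℓ i j) → Measurable fun ℓ => (V ℓ).det := by
    intro k V hV
    simp only [Matrix.det_apply]
    exact Finset.measurable_sum _ fun σ _ =>
      (Finset.measurable_prod _ fun i _ => hV _ _).const_smul _
  simp only [Matrix.inv_def, Ring.inverse_eq_inv', Matrix.smul_apply, smul_eq_mul]
  refine (hdet hU).inv.mul ?_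
  simp only [Matrix.adjugate_apply]
  refine hdet fun a b => ?_
  by_cases h : a = j
  · subst h; simp
  · simpa [Matrix.updateRow_apply, h] using hU a b

theorem MemH.add {U V : Θ → Matrix (Fin n) (Fin m) ℝ} (hU : MemH μ U) (hV : MemH μ V) :
    MemH μ fun ℓ => U ℓ + V ℓ := by
  obtain ⟨c, hc⟩ := hU.2
  obtain ⟨d, hd⟩ := hV.2
  refine ⟨fun i j => (hU.1 i j).add (hV.1 i j), c + d, ?_⟩
  filter_upwards [hc, hd] with ℓ h1 h2
  exact (norm_add_le _ _).trans (add_le_add h1 h2)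

theorem MemH.smul {U : Θ → Matrix (Fin n) (Fin m) ℝ} (hU : MemH μ U) (a : ℝ) :
    MemH μ fun ℓ => a • U ℓ := by
  obtain ⟨c, hc⟩ := hU.2
  refine ⟨fun i j => (hU.1 i j).const_mul a, ‖a‖ * c, ?_⟩
  filter_upwards [hc] with ℓ h1
  rw [norm_smul]
  gcongr

theorem MemH.neg {U : Θ → Matrix (Fin n) (Fin m) ℝ} (hU : MemH μ U) : MemH μ fun ℓ => -U ℓ := by
  simpa using hU.smul (-1)

theorem MemH.sub {U V : Θ → Matrix (Fin n) (Fin m) ℝ} (hU : MemH μ U) (hV : MemH μ V) :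
    MemH μ fun ℓ => U ℓ - V ℓ := by
  simpa [sub_eq_add_neg] using hU.add hV.neg

theorem MemH.mul {U : Θ → Matrix (Fin n) (Fin m) ℝ} {V : Θ → Matrix (Fin m) (Fin p) ℝ}
    (hU : MemH μ U) (hV : MemH μ V) : MemH μ fun ℓ => U ℓ * V ℓ := by
  obtain ⟨c, hc0, hc⟩ := hU.exists_norm_le
  obtain ⟨d, -, hd⟩ := hV.exists_norm_le
  refine ⟨measurable_mul_apply hU.1 hV.1, c * d, ?_⟩
  filter_upwards [hc, hd] with ℓ h1 h2
  exact (Matrix.l2_opNorm_mul _ _).trans (by gcongr)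

theorem MemH.transpose {U : Θ → Matrix (Fin n) (Fin m) ℝ} (hU : MemH μ U) :
    MemH μ fun ℓ => (U ℓ)ᵀ := by
  obtain ⟨c, hc⟩ := hU.2
  refine ⟨fun i j => hU.1 j i, c, ?_⟩
  filter_upwards [hc] with ℓ h1
  rwa [← Matrix.conjTranspose_eq_transpose_of_trivial, Matrix.l2_opNorm_conjTranspose]

theorem memH_const (B : Matrix (Fin n) (Fin m) ℝ) : MemH μ fun _ => B :=
  ⟨fun _ _ => measurable_const, ‖B‖, by simp⟩

theorem memH_of_nonneg_of_le {U : Θ → Matrix (Fin n) (Fin n) ℝ}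
    (hm : ∀ i j, Measurable fun ℓ => U ℓ i j) {c : ℝ} (h0 : ∀ᵐ ℓ ∂μ, 0 ≤ U ℓ)
    (h : ∀ᵐ ℓ ∂μ, U ℓ ≤ c • 1) : MemH μ U :=
  memH_of_abs_apply_le (c := c) hm (by
    filter_upwards [h0, h] with ℓ h1 h2 i j
    exact abs_apply_le_of_le_smul_one h1 h2 i j)

theorem MemH.le_smul_one {U : Θ → Matrix (Fin n) (Fin n) ℝ} (hU : MemH μ U)
    (hs : ∀ᵐ ℓ ∂μ, (U ℓ).IsSymm) : ∃ c : ℝ, 0 < c ∧ ∀ᵐ ℓ ∂μ, U ℓ ≤ c • 1 := by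
  obtain ⟨c, hc0, hc⟩ := hU.exists_norm_le
  refine ⟨c, hc0, ?_⟩
  filter_upwards [hc, hs] with ℓ h1 h2
  exact le_smul_one_of_norm_le h2 h1

/-- The square root is continuous on the closed cone of positive semidefinite matrices and is zero
by default off it, hence Borel. This covers the null set where `Q` is not nonnegative. -/
theorem measurable_sqrtFun_apply {Q : Θ → Matrix (Fin n) (Fin n) ℝ}
    (hQ : ∀ i j, Measurable fun ℓ => Q ℓ i j) (i j : Fin n) :
    Measurable fun ℓ => sqrtFun Q ℓ i j := by
  let _ : MeasurableSpace (Matrix (Fin n) (Fin n) ℝ) := borel _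
  have : BorelSpace (Matrix (Fin n) (Fin n) ℝ) := ⟨rfl⟩
  have hsingle : Measurable Q := by
    have : Q = fun ℓ => ∑ i, ∑ j, Q ℓ i j • Matrix.single i j (1 : ℝ) := by
      ext1 ℓ
      conv_lhs => rw [Matrix.matrix_eq_sum_single (Q ℓ)]
      simp
    rw [this]
    refine Finset.measurable_sum _ fun i _ => Finset.measurable_sum _ fun j _ => ?_
    exact (hQ i j).smul_const _
  classical
  have hS : Measurable (CFC.sqrt : Matrix (Fin n) (Fin n) ℝ → Matrix (Fin n) (Fin n) ℝ) := by
    have heq : (CFC.sqrt : Matrix (Fin n) (Fin n) ℝ → Matrix (Fin n) (Fin n) ℝ) =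
        Set.piecewise {a | 0 ≤ a} CFC.sqrt (fun _ => 0) := by
      ext1 a
      by_cases ha : 0 ≤ a
      · simp [Set.piecewise, ha]
      · simp [Set.piecewise, ha, CFC.sqrt_of_not_nonneg ha]
    rw [heq]
    exact continuousOn_sqrt.measurable_piecewise continuousOn_const isClosed_nonneg.measurableSet
  have happ : Continuous fun a : Matrix (Fin n) (Fin n) ℝ => a i j := by fun_prop
  exact happ.measurable.comp (hS.comp hsingle)

theorem sqrtFun_transpose_mul_self {X : Type*} {Q : X → Matrix (Fin n) (Fin n) ℝ} {ℓ : X}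
    (h : 0 ≤ Q ℓ) :
    (sqrtFun Q ℓ)ᵀ * sqrtFun Q ℓ = Q ℓ := by
  have h1 : (sqrtFun Q ℓ)ᵀ = sqrtFun Q ℓ := isSymm_of_nonneg (CFC.sqrt_nonneg (Q ℓ))
  rw [h1]
  exact CFC.sqrt_mul_sqrt_self _ h

theorem memH_sqrtFun {Q : Θ → Matrix (Fin n) (Fin n) ℝ} (hQ : MemH μ Q)
    (h0 : ∀ᵐ ℓ ∂μ, 0 ≤ Q ℓ) : MemH μ (sqrtFun Q) := by
  obtain ⟨c, -, hc⟩ := hQ.exists_norm_le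
  -- For `s = ‖Q^{1/2}‖`, `s² = ‖Q‖ ≤ c` and `2 s ≤ 1 + s²` give `s ≤ 1 + c`.
  refine ⟨measurable_sqrtFun_apply hQ.1, 1 + c, ?_⟩
  filter_upwards [hc, h0] with ℓ h1 h2
  have h3 := Matrix.l2_opNorm_conjTranspose_mul_self (sqrtFun Q ℓ)
  rw [Matrix.conjTranspose_eq_transpose_of_trivial, sqrtFun_transpose_mul_self h2] at h3
  nlinarith [sq_nonneg (‖sqrtFun Q ℓ‖ - 1), norm_nonneg (sqrtFun Q ℓ)]

end MemH

/-! ### Averaging along the transition kernel and the Lyapunov operator -/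

section Averaging

variable {Θ : Type*} [MeasurableSpace Θ] {μ : Measure Θ} {n m : ℕ} {𝔾 : Kernel Θ Θ}

/-- The entrywise average of a matrix function along a kernel. -/
noncomputable def kernE (𝔾 : Kernel Θ Θ) (U : Θ → Matrix (Fin n) (Fin n) ℝ) :
    Θ → Matrix (Fin n) (Fin n) ℝ :=
  fun ℓ => Matrix.of fun i j => ∫ t, U t i j ∂𝔾 ℓ

/-- The Lyapunov operator `U ↦ Fᵀ 𝓔(U) F`. -/
noncomputable def lyap (𝔾 : Kernel Θ Θ) (F : Θ → Matrix (Fin n) (Fin n) ℝ)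
    (U : Θ → Matrix (Fin n) (Fin n) ℝ) : Θ → Matrix (Fin n) (Fin n) ℝ :=
  fun ℓ => (F ℓ)ᵀ * kernE 𝔾 U ℓ * F ℓ

/-- Only the sections `g ℓ` are assumed measurable. In kernel form, measurability of the average in
`ℓ` comes from that of `𝔾`. -/
theorem opE_eq_kernE {g : Θ → Θ → ℝ} (hg_meas : ∀ ℓ, Measurable (g ℓ))
    (hg_nonneg : ∀ ℓ t, 0 ≤ g ℓ t)
    (hg : ∀ ℓ, 𝔾 ℓ = μ.withDensity fun t => ENNReal.ofReal (g ℓ t))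
    (U : Θ → Matrix (Fin n) (Fin n) ℝ) : opE μ g U = kernE 𝔾 U := by
  ext ℓ i j
  simp only [opE, kernE, Matrix.of_apply, hg]
  have := integral_withDensity_eq_integral_smul (μ := μ) (f := fun t => (g ℓ t).toNNReal)
    (hg_meas ℓ).real_toNNReal (fun t => U t i j)
  simp only [ENNReal.ofReal]
  rw [this]
  refine integral_congr_ae (Eventually.of_forall fun t => ?_)
  simp [NNReal.smul_def, hg_nonneg]

theorem measurable_kernE_apply {U : Θ → Matrix (Fin n) (Fin n) ℝ}
    (hU : ∀ i j, Measurable fun ℓ => U ℓ i j) (i j : Fin n) :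
    Measurable fun ℓ => kernE 𝔾 U ℓ i j := by
  simp only [kernE, Matrix.of_apply]
  exact ((hU i j).stronglyMeasurable.integral_kernel).measurable

theorem kernE_isSymm {U : Θ → Matrix (Fin n) (Fin n) ℝ} (hU : ∀ ℓ, (U ℓ).IsSymm) (ℓ : Θ) :
    (kernE 𝔾 U ℓ).IsSymm := by
  ext i j
  simp only [kernE, Matrix.transpose_apply, Matrix.of_apply]
  congr 1
  ext t
  exact (hU t).apply i j

theorem lyap_isSymm {U : Θ → Matrix (Fin n) (Fin n) ℝ} (hU : ∀ ℓ, (U ℓ).IsSymm)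
    (F : Θ → Matrix (Fin n) (Fin n) ℝ) (ℓ : Θ) : (lyap 𝔾 F U ℓ).IsSymm :=
  isSymm_conj (kernE_isSymm hU ℓ) _

theorem kernE_smul (U : Θ → Matrix (Fin n) (Fin n) ℝ) (a : ℝ) (ℓ : Θ) :
    kernE 𝔾 (fun t => a • U t) ℓ = a • kernE 𝔾 U ℓ := by
  ext i j
  simp [kernE, integral_const_mul]

theorem lyap_smul (F U : Θ → Matrix (Fin n) (Fin n) ℝ) (a : ℝ) (ℓ : Θ) :
    lyap 𝔾 F (fun t => a • U t) ℓ = a • lyap 𝔾 F U ℓ := by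
  simp [lyap, kernE_smul]

variable [IsMarkovKernel 𝔾]

theorem MemH.integrable_apply (hac : ∀ ℓ, 𝔾 ℓ ≪ μ) {U : Θ → Matrix (Fin n) (Fin m) ℝ}
    (hU : MemH μ U) (ℓ : Θ) (i : Fin n) (j : Fin m) : Integrable (fun t => U t i j) (𝔾 ℓ) := by
  obtain ⟨c, -, hc⟩ := hU.abs_apply_le
  refine Integrable.of_bound (hU.1 i j).aestronglyMeasurable c ?_
  filter_upwards [(hac ℓ).ae_le hc] with t ht
  simpa using ht i j

theorem memH_kernE (hac : ∀ ℓ, 𝔾 ℓ ≪ μ) {U : Θ → Matrix (Fin n) (Fin n) ℝ} (hU : MemH μ U) :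
    MemH μ (kernE 𝔾 U) := by
  obtain ⟨c, -, hc⟩ := hU.abs_apply_le
  refine memH_of_abs_apply_le (c := c) (measurable_kernE_apply hU.1)
    (Eventually.of_forall fun ℓ i j => ?_)
  have := norm_integral_le_of_norm_le_const (μ := 𝔾 ℓ) (f := fun t => U t i j) (C := c)
    (by filter_upwards [(hac ℓ).ae_le hc] with t ht; simpa using ht i j)
  simpa [kernE] using this

theorem memH_lyap (hac : ∀ ℓ, 𝔾 ℓ ≪ μ) {F U : Θ → Matrix (Fin n) (Fin n) ℝ} (hF : MemH μ F)
    (hU : MemH μ U) : MemH μ (lyap 𝔾 F U) :=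
  (hF.transpose.mul (memH_kernE hac hU)).mul hF

theorem kernE_add (hac : ∀ ℓ, 𝔾 ℓ ≪ μ) {U V : Θ → Matrix (Fin n) (Fin n) ℝ} (hU : MemH μ U)
    (hV : MemH μ V) (ℓ : Θ) :
    kernE 𝔾 (fun t => U t + V t) ℓ = kernE 𝔾 U ℓ + kernE 𝔾 V ℓ := by
  ext i j
  simp [kernE, integral_add (hU.integrable_apply hac ℓ i j) (hV.integrable_apply hac ℓ i j)]

theorem kernE_sub (hac : ∀ ℓ, 𝔾 ℓ ≪ μ) {U V : Θ → Matrix (Fin n) (Fin n) ℝ} (hU : MemH μ U)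
    (hV : MemH μ V) (ℓ : Θ) :
    kernE 𝔾 (fun t => U t - V t) ℓ = kernE 𝔾 U ℓ - kernE 𝔾 V ℓ := by
  ext i j
  simp [kernE, integral_sub (hU.integrable_apply hac ℓ i j) (hV.integrable_apply hac ℓ i j)]

theorem lyap_add (hac : ∀ ℓ, 𝔾 ℓ ≪ μ) {U V : Θ → Matrix (Fin n) (Fin n) ℝ} (hU : MemH μ U)
    (hV : MemH μ V) (F : Θ → Matrix (Fin n) (Fin n) ℝ) (ℓ : Θ) :
    lyap 𝔾 F (fun t => U t + V t) ℓ = lyap 𝔾 F U ℓ + lyap 𝔾 F V ℓ := by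
  simp [lyap, kernE_add hac hU hV, Matrix.mul_add, Matrix.add_mul]

theorem lyap_sub (hac : ∀ ℓ, 𝔾 ℓ ≪ μ) {U V : Θ → Matrix (Fin n) (Fin n) ℝ} (hU : MemH μ U)
    (hV : MemH μ V) (F : Θ → Matrix (Fin n) (Fin n) ℝ) (ℓ : Θ) :
    lyap 𝔾 F (fun t => U t - V t) ℓ = lyap 𝔾 F U ℓ - lyap 𝔾 F V ℓ := by
  simp [lyap, kernE_sub hac hU hV, Matrix.mul_sub, Matrix.sub_mul]

theorem integrable_quadForm (hac : ∀ ℓ, 𝔾 ℓ ≪ μ) {U : Θ → Matrix (Fin n) (Fin n) ℝ}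
    (hU : MemH μ U) (ℓ : Θ) (x : Fin n → ℝ) :
    Integrable (fun t => x ⬝ᵥ U t *ᵥ x) (𝔾 ℓ) := by
  simp only [dotProduct, Matrix.mulVec]
  exact integrable_finsetSum _ fun i _ => (integrable_finsetSum _ fun j _ =>
    (hU.integrable_apply hac ℓ i j).mul_const _).const_mul _

theorem quadForm_kernE (hac : ∀ ℓ, 𝔾 ℓ ≪ μ) {U : Θ → Matrix (Fin n) (Fin n) ℝ} (hU : MemH μ U)
    (ℓ : Θ) (x : Fin n → ℝ) : x ⬝ᵥ kernE 𝔾 U ℓ *ᵥ x = ∫ t, x ⬝ᵥ U t *ᵥ x ∂𝔾 ℓ := by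
  simp only [dotProduct, Matrix.mulVec, kernE, Matrix.of_apply]
  have hi : ∀ i j, Integrable (fun t => U t i j * x j) (𝔾 ℓ) := fun i j =>
    (hU.integrable_apply hac ℓ i j).mul_const _
  rw [integral_finsetSum _ fun i _ => (integrable_finsetSum _ fun j _ => hi i j).const_mul _]
  refine Finset.sum_congr rfl fun i _ => ?_
  rw [integral_const_mul, integral_finsetSum _ fun j _ => hi i j]
  simp only [integral_mul_const]

/-- The hypothesis holds almost everywhere but the conclusion everywhere, because every `𝔾 ℓ` is
absolutely continuous with respect to `μ`. -/
theorem kernE_nonneg (hac : ∀ ℓ, 𝔾 ℓ ≪ μ) {U : Θ → Matrix (Fin n) (Fin n) ℝ} (hU : MemH μ U)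
    (h0 : ∀ᵐ ℓ ∂μ, 0 ≤ U ℓ) (ℓ : Θ) : 0 ≤ kernE 𝔾 U ℓ := by
  rw [nonneg_iff_quadForm]
  constructor
  · ext i j
    simp only [kernE, Matrix.transpose_apply, Matrix.of_apply]
    refine integral_congr_ae ?_
    filter_upwards [(hac ℓ).ae_le h0] with t ht
    exact (isSymm_of_nonneg ht).apply i j
  · intro x
    rw [quadForm_kernE hac hU]
    refine integral_nonneg_of_ae ?_
    filter_upwards [(hac ℓ).ae_le h0] with t ht
    exact (nonneg_iff_quadForm.1 ht).2 x

theorem kernE_mono (hac : ∀ ℓ, 𝔾 ℓ ≪ μ) {U V : Θ → Matrix (Fin n) (Fin n) ℝ} (hU : MemH μ U)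
    (hV : MemH μ V) (h : ∀ᵐ ℓ ∂μ, U ℓ ≤ V ℓ) (ℓ : Θ) : kernE 𝔾 U ℓ ≤ kernE 𝔾 V ℓ := by
  rw [← sub_nonneg, ← kernE_sub hac hV hU]
  exact kernE_nonneg hac (hV.sub hU) (h.mono fun ℓ hℓ => sub_nonneg.2 hℓ) ℓ

theorem lyap_nonneg (hac : ∀ ℓ, 𝔾 ℓ ≪ μ) {U : Θ → Matrix (Fin n) (Fin n) ℝ} (hU : MemH μ U)
    (h0 : ∀ᵐ ℓ ∂μ, 0 ≤ U ℓ) (F : Θ → Matrix (Fin n) (Fin n) ℝ) (ℓ : Θ) : 0 ≤ lyap 𝔾 F U ℓ :=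
  conj_nonneg (kernE_nonneg hac hU h0 ℓ) _

theorem lyap_mono (hac : ∀ ℓ, 𝔾 ℓ ≪ μ) {U V : Θ → Matrix (Fin n) (Fin n) ℝ} (hU : MemH μ U)
    (hV : MemH μ V) (h : ∀ᵐ ℓ ∂μ, U ℓ ≤ V ℓ) (F : Θ → Matrix (Fin n) (Fin n) ℝ) (ℓ : Θ) :
    lyap 𝔾 F U ℓ ≤ lyap 𝔾 F V ℓ :=
  conj_mono (kernE_mono hac hU hV h ℓ) _

end Averaging

/-! ### The Markov chain -/

section Chain

variable {Θ : Type*} [MeasurableSpace Θ] {μ : Measure Θ} {n : ℕ} {𝔾 : Kernel Θ Θ}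
  [IsMarkovKernel 𝔾]

theorem lintegral_chainLaw_zero {μ₀ : Measure Θ} [IsProbabilityMeasure μ₀] {f : Θ → ℝ≥0∞}
    (hf : Measurable f) : ∫⁻ ϑ, f (ϑ 0) ∂chainLaw 𝔾 μ₀ = ∫⁻ ℓ, f ℓ ∂μ₀ := by
  have hev : Measurable fun h : (i : Finset.Iic 0) → Θ => h ⟨0, by simp⟩ := measurable_pi_apply _
  have hfev : Measurable fun h : (i : Finset.Iic 0) → Θ => f (h ⟨0, by simp⟩) := hf.comp hev
  have h1 : (chainLaw 𝔾 μ₀).map (Preorder.frestrictLe (π := fun _ : ℕ => Θ) 0) =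
      μ₀.map (MeasurableEquiv.piUnique fun _ : Finset.Iic 0 => Θ).symm := by
    rw [chainLaw, Kernel.trajMeasure, Measure.map_comp _ _ (by fun_prop),
      Kernel.traj_map_frestrictLe, Kernel.partialTraj_self]
    exact Measure.id_comp
  have h2 : ∫⁻ ϑ, f (ϑ 0) ∂chainLaw 𝔾 μ₀ =
      ∫⁻ h, f (h ⟨0, by simp⟩) ∂(chainLaw 𝔾 μ₀).map
        (Preorder.frestrictLe (π := fun _ : ℕ => Θ) 0) := by
    rw [lintegral_map hfev (by fun_prop)]
    rfl
  rw [h2, h1, lintegral_map hfev (by fun_prop)]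
  rfl

/-- The Markov property: the joint law of the history and the next mode is the law of the history
composed with `𝔾` at the current mode. -/
theorem lintegral_chainLaw_succ {μ₀ : Measure Θ} [IsProbabilityMeasure μ₀] (k : ℕ)
    {f : ((i : Finset.Iic k) → Θ) × Θ → ℝ≥0∞} (hf : Measurable f) :
    ∫⁻ ϑ, f (Preorder.frestrictLe (π := fun _ : ℕ => Θ) k ϑ, ϑ (k + 1)) ∂chainLaw 𝔾 μ₀ =
      ∫⁻ ϑ, ∫⁻ t, f (Preorder.frestrictLe (π := fun _ : ℕ => Θ) k ϑ, t) ∂𝔾 (ϑ k)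
        ∂chainLaw 𝔾 μ₀ := by
  have h := Kernel.map_frestrictLe_trajMeasure_compProd_eq_map_trajMeasure (X := fun _ : ℕ => Θ)
    (κ := fun k => 𝔾.comap (fun h : (i : Finset.Iic k) → Θ => h ⟨k, Finset.mem_Iic.2 le_rfl⟩)
      (measurable_pi_apply _)) (μ₀ := μ₀) (a := k)
  have h1 := congrArg (fun ν => ∫⁻ z, f z ∂ν) h
  rw [lintegral_map hf (by fun_prop)] at h1
  have hP : IsProbabilityMeasure ((Kernel.trajMeasure (X := fun _ : ℕ => Θ) μ₀ fun k =>
    𝔾.comap (fun h : (i : Finset.Iic k) → Θ => h ⟨k, Finset.mem_Iic.2 le_rfl⟩)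
      (measurable_pi_apply _)).map (Preorder.frestrictLe k)) :=
    Measure.isProbabilityMeasure_map (by fun_prop)
  rw [Measure.lintegral_compProd hf, lintegral_map hf.lintegral_kernel_prod_right' (by fun_prop)]
    at h1
  exact h1.symm

theorem state_congr {X : Type*} (F : X → Matrix (Fin n) (Fin n) ℝ)
    (x₀ : EuclideanSpace ℝ (Fin n)) {ϑ ϑ' : ℕ → X} :
    ∀ k : ℕ, (∀ i < k, ϑ i = ϑ' i) → state F x₀ ϑ k = state F x₀ ϑ' k
  | 0, _ => rfl
  | k + 1, h => by
    rw [state, state, state_congr F x₀ k fun i hi => h i (hi.trans k.lt_succ_self),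
      h k k.lt_succ_self]

theorem measurable_state_apply {F : Θ → Matrix (Fin n) (Fin n) ℝ}
    (hF : ∀ i j, Measurable fun ℓ => F ℓ i j) (x₀ : EuclideanSpace ℝ (Fin n)) :
    ∀ (k : ℕ) (i : Fin n), Measurable fun ϑ : ℕ → Θ => (state F x₀ ϑ k).ofLp i
  | 0, i => by simp only [state]; exact measurable_const
  | k + 1, i => by
    simp only [state, Matrix.mulVec, dotProduct]
    exact Finset.measurable_sum _ fun j _ =>
      ((hF i j).comp (measurable_pi_apply k)).mul (measurable_state_apply hF x₀ k j)

theorem lintegral_quadForm (hac : ∀ ℓ, 𝔾 ℓ ≪ μ) {U : Θ → Matrix (Fin n) (Fin n) ℝ}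
    (hU : MemH μ U) (h0 : ∀ᵐ ℓ ∂μ, 0 ≤ U ℓ) (ℓ : Θ) (x : Fin n → ℝ) :
    ∫⁻ t, ENNReal.ofReal (x ⬝ᵥ U t *ᵥ x) ∂𝔾 ℓ =
      ENNReal.ofReal (x ⬝ᵥ kernE 𝔾 U ℓ *ᵥ x) := by
  rw [quadForm_kernE hac hU, ofReal_integral_eq_lintegral_ofReal (integrable_quadForm hac hU ℓ x)]
  filter_upwards [(hac ℓ).ae_le h0] with t ht
  exact (nonneg_iff_quadForm.1 ht).2 x

theorem measurable_quadForm_of {X : Type*} [MeasurableSpace X] {U : X → Matrix (Fin n) (Fin n) ℝ}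
    {x : X → Fin n → ℝ} (hU : ∀ i j, Measurable fun ℓ => U ℓ i j)
    (hx : ∀ i, Measurable fun ℓ => x ℓ i) : Measurable fun ℓ => x ℓ ⬝ᵥ U ℓ *ᵥ x ℓ := by
  simp only [dotProduct, Matrix.mulVec]
  exact Finset.measurable_sum _ fun i _ => (hx i).mul
    (Finset.measurable_sum _ fun j _ => (hU i j).mul (hx j))

/-- One step of the dynamics acts on expected quadratic forms through the Lyapunov operator. -/
theorem lintegral_quadForm_state_succ (hac : ∀ ℓ, 𝔾 ℓ ≪ μ) {F U : Θ → Matrix (Fin n) (Fin n) ℝ}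
    (hF : MemH μ F) (hU : MemH μ U) (h0 : ∀ᵐ ℓ ∂μ, 0 ≤ U ℓ) (x₀ : EuclideanSpace ℝ (Fin n))
    {μ₀ : Measure Θ} [IsProbabilityMeasure μ₀] (k : ℕ) :
    ∫⁻ ϑ, ENNReal.ofReal ((state F x₀ ϑ (k + 1)).ofLp ⬝ᵥ U (ϑ (k + 1)) *ᵥ
        (state F x₀ ϑ (k + 1)).ofLp) ∂chainLaw 𝔾 μ₀ =
      ∫⁻ ϑ, ENNReal.ofReal ((state F x₀ ϑ k).ofLp ⬝ᵥ lyap 𝔾 F U (ϑ k) *ᵥ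
        (state F x₀ ϑ k).ofLp) ∂chainLaw 𝔾 μ₀ := by
  -- `e` extends a history to a full trajectory by freezing it at time `k`. Since `x(k+1)` depends
  -- only on the modes up to time `k`, it is unchanged.
  set e : ((i : Finset.Iic k) → Θ) → ℕ → Θ :=
    fun h i => h ⟨min i k, Finset.mem_Iic.2 (min_le_right _ _)⟩ with he
  have he_meas : Measurable e := measurable_pi_lambda _ fun i => measurable_pi_apply _
  have hstate : ∀ ϑ : ℕ → Θ,
      state F x₀ (e (Preorder.frestrictLe (π := fun _ : ℕ => Θ) k ϑ)) (k + 1) =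
        state F x₀ ϑ (k + 1) := fun ϑ => state_congr F x₀ _ fun i hi => by
    simp [he, Preorder.frestrictLe, Nat.min_eq_left (Nat.lt_succ_iff.1 hi)]
  have hmeas : Measurable fun z : ((i : Finset.Iic k) → Θ) × Θ =>
      ENNReal.ofReal ((state F x₀ (e z.1) (k + 1)).ofLp ⬝ᵥ U z.2 *ᵥ
        (state F x₀ (e z.1) (k + 1)).ofLp) :=
    (measurable_quadForm_of (fun i j => (hU.1 i j).comp measurable_snd) fun i =>
      (measurable_state_apply hF.1 x₀ (k + 1) i).comp (he_meas.comp measurable_fst)).ennreal_ofReal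
  have h := lintegral_chainLaw_succ (𝔾 := 𝔾) (μ₀ := μ₀) k hmeas
  simp only [hstate] at h
  rw [h]
  refine lintegral_congr fun ϑ => ?_
  rw [lintegral_quadForm hac hU h0, lyap, quadForm_conj]
  rfl

theorem memH_lyap_iterate (hac : ∀ ℓ, 𝔾 ℓ ≪ μ) {F : Θ → Matrix (Fin n) (Fin n) ℝ}
    (hF : MemH μ F) {U : Θ → Matrix (Fin n) (Fin n) ℝ} (hU : MemH μ U) (k : ℕ) :
    MemH μ ((lyap 𝔾 F)^[k] U) := by
  induction k with
  | zero => exact hU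
  | succ k ih => rw [Function.iterate_succ_apply']; exact memH_lyap hac hF ih

theorem lyap_iterate_nonneg (hac : ∀ ℓ, 𝔾 ℓ ≪ μ) {F : Θ → Matrix (Fin n) (Fin n) ℝ}
    (hF : MemH μ F) {U : Θ → Matrix (Fin n) (Fin n) ℝ} (hU : MemH μ U) (h0 : ∀ᵐ ℓ ∂μ, 0 ≤ U ℓ)
    (k : ℕ) : ∀ᵐ ℓ ∂μ, 0 ≤ (lyap 𝔾 F)^[k] U ℓ := by
  induction k with
  | zero => exact h0
  | succ k ih =>
    rw [Function.iterate_succ_apply']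
    exact Eventually.of_forall fun ℓ => lyap_nonneg hac (memH_lyap_iterate hac hF hU k) ih F ℓ

/-- `U` is general in the induction: each step back in time replaces the weight `U` by `lyap 𝔾 F U`.
-/
theorem lintegral_quadForm_state (hac : ∀ ℓ, 𝔾 ℓ ≪ μ) {F : Θ → Matrix (Fin n) (Fin n) ℝ}
    (hF : MemH μ F) (x₀ : EuclideanSpace ℝ (Fin n)) {μ₀ : Measure Θ} [IsProbabilityMeasure μ₀]
    (k : ℕ) : ∀ {U : Θ → Matrix (Fin n) (Fin n) ℝ}, MemH μ U → (∀ᵐ ℓ ∂μ, 0 ≤ U ℓ) →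
    ∫⁻ ϑ, ENNReal.ofReal ((state F x₀ ϑ k).ofLp ⬝ᵥ U (ϑ k) *ᵥ (state F x₀ ϑ k).ofLp)
        ∂chainLaw 𝔾 μ₀ =
      ∫⁻ ℓ, ENNReal.ofReal (x₀.ofLp ⬝ᵥ (lyap 𝔾 F)^[k] U ℓ *ᵥ x₀.ofLp) ∂μ₀ := by
  induction k with
  | zero =>
    intro U hU _
    exact lintegral_chainLaw_zero
      (f := fun ℓ => ENNReal.ofReal (x₀.ofLp ⬝ᵥ U ℓ *ᵥ x₀.ofLp))
      (measurable_quadForm_of (x := fun _ => x₀.ofLp) hU.1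
        fun i => measurable_const).ennreal_ofReal
  | succ k ih =>
    intro U hU h0
    rw [lintegral_quadForm_state_succ hac hF hU h0, ih (memH_lyap hac hF hU)
      (Eventually.of_forall fun ℓ => lyap_nonneg hac hU h0 F ℓ), Function.iterate_succ_apply]

theorem lintegral_norm_sq_state (hac : ∀ ℓ, 𝔾 ℓ ≪ μ) {F : Θ → Matrix (Fin n) (Fin n) ℝ}
    (hF : MemH μ F) (x₀ : EuclideanSpace ℝ (Fin n)) {μ₀ : Measure Θ} [IsProbabilityMeasure μ₀]
    (k : ℕ) : ∫⁻ ϑ, ENNReal.ofReal (‖state F x₀ ϑ k‖ ^ 2) ∂chainLaw 𝔾 μ₀ =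
      ∫⁻ ℓ, ENNReal.ofReal (x₀.ofLp ⬝ᵥ (lyap 𝔾 F)^[k] (fun _ => 1) ℓ *ᵥ x₀.ofLp) ∂μ₀ := by
  rw [← lintegral_quadForm_state hac hF x₀ k (memH_const 1)
    (Eventually.of_forall fun _ => one_nonneg_matrix)]
  simp only [Matrix.one_mulVec, dotProduct_self_eq_norm_sq]

end Chain

/-! ### The Lyapunov characterization of exponential mean-square stability -/

section Lyapunov

variable {Θ : Type*} [MeasurableSpace Θ] {μ : Measure Θ} {n : ℕ} {𝔾 : Kernel Θ Θ}

/-- `Z` is a Lyapunov function with decay factor `ρ` and condition number `c` for the closed loop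
matrix function `F`. -/
structure IsLyapunov (μ : Measure Θ) (𝔾 : Kernel Θ Θ) (F Z : Θ → Matrix (Fin n) (Fin n) ℝ)
    (c ρ : ℝ) : Prop where
  memH : MemH μ Z
  one_le_c : 1 ≤ c
  rho_pos : 0 < ρ
  rho_lt_one : ρ < 1
  one_le : ∀ᵐ ℓ ∂μ, 1 ≤ Z ℓ
  le_smul_one : ∀ᵐ ℓ ∂μ, Z ℓ ≤ c • 1
  lyap_le : ∀ᵐ ℓ ∂μ, lyap 𝔾 F Z ℓ ≤ ρ • Z ℓ

theorem IsLyapunov.nonneg {F Z : Θ → Matrix (Fin n) (Fin n) ℝ} {c ρ : ℝ}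
    (h : IsLyapunov μ 𝔾 F Z c ρ) : ∀ᵐ ℓ ∂μ, 0 ≤ Z ℓ :=
  h.one_le.mono fun _ hℓ => one_nonneg_matrix.trans hℓ

variable [IsMarkovKernel 𝔾]

/-- From `1 ≤ Z`, monotonicity and `T_F(Z) ≤ ρ Z` give `T_F^k(1) ≤ ρ^k Z ≤ c ρ^k`, to be integrated
against `μ₀ ≪ μ`. -/
theorem IsLyapunov.emss (hac : ∀ ℓ, 𝔾 ℓ ≪ μ) {F Z : Θ → Matrix (Fin n) (Fin n) ℝ} {c ρ : ℝ}
    (hF : MemH μ F) (h : IsLyapunov μ 𝔾 F Z c ρ) : EMSS μ 𝔾 F := by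
  have hk : ∀ k : ℕ, ∀ᵐ ℓ ∂μ, (lyap 𝔾 F)^[k] (fun _ => 1) ℓ ≤ ρ ^ k • Z ℓ := by
    intro k
    induction k with
    | zero => simpa using h.one_le
    | succ k ih =>
      filter_upwards [h.lyap_le] with ℓ hℓ
      rw [Function.iterate_succ_apply']
      refine (lyap_mono hac (memH_lyap_iterate hac hF (memH_const 1) k) (h.memH.smul _) ih F
        ℓ).trans ?_
      rw [lyap_smul, pow_succ, mul_smul]
      exact smul_le_smul_matrix (pow_nonneg h.rho_pos.le k) hℓ
  refine ⟨c, ρ, h.one_le_c, h.rho_pos, h.rho_lt_one, fun x₀ μ₀ hμ₀ hμ₀μ k => ?_⟩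
  rw [lintegral_norm_sq_state hac hF]
  calc _ ≤ ∫⁻ _, ENNReal.ofReal (c * ρ ^ k * ‖x₀‖ ^ 2) ∂μ₀ := by
        refine lintegral_mono_ae ?_
        filter_upwards [hμ₀μ.ae_le (hk k), hμ₀μ.ae_le h.le_smul_one] with ℓ h1 h2
        have h3 := h1.trans (smul_le_smul_matrix (pow_nonneg h.rho_pos.le k) h2)
        refine ENNReal.ofReal_le_ofReal ((quadForm_mono h3 x₀.ofLp).trans_eq ?_)
        rw [smul_smul, Matrix.smul_mulVec, Matrix.one_mulVec, dotProduct_smul,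
          dotProduct_self_eq_norm_sq, smul_eq_mul]
        ring
    _ = _ := by simp

/-- Conditioning `μ` on a set of finite positive measure gives an admissible initial law. By
σ-finiteness these sets detect the pointwise bound. -/
theorem ae_le_of_forall_probability_lintegral_le [SigmaFinite μ] {f : Θ → ℝ≥0∞}
    (hf : Measurable f) {c : ℝ≥0∞}
    (h : ∀ μ₀ : Measure Θ, IsProbabilityMeasure μ₀ → μ₀ ≪ μ → ∫⁻ ℓ, f ℓ ∂μ₀ ≤ c) :
    ∀ᵐ ℓ ∂μ, f ℓ ≤ c := by
  refine ae_le_of_forall_setLIntegral_le_of_sigmaFinite (g := fun _ => c) hf fun s hs hsμ => ?_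
  by_cases h0 : μ s = 0
  · simp [Measure.restrict_eq_zero.2 h0]
  · have h1 := h (ProbabilityTheory.cond μ s) (cond_isProbabilityMeasure_of_finite h0 hsμ.ne)
      cond_absolutelyContinuous
    rw [ProbabilityTheory.cond, lintegral_smul_measure, smul_eq_mul, mul_comm,
      ← div_eq_mul_inv, ENNReal.div_le_iff h0 hsμ.ne] at h1
    simpa using h1

/-- Initial states `e_i` bound the diagonal entries almost everywhere. There are finitely many of
them, so the null sets combine, and positivity upgrades this to a matrix bound. -/
theorem EMSS.lyap_iterate_le [SigmaFinite μ] (hac : ∀ ℓ, 𝔾 ℓ ≪ μ)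
    {F : Θ → Matrix (Fin n) (Fin n) ℝ} (hF : MemH μ F) (h : EMSS μ 𝔾 F) :
    ∃ β α : ℝ, 0 < α ∧ α < 1 ∧
      ∀ k : ℕ, ∀ᵐ ℓ ∂μ, (lyap 𝔾 F)^[k] (fun _ => 1) ℓ ≤ (β * α ^ k) • 1 := by
  obtain ⟨β, α, hβ, hα0, hα1, h⟩ := h
  refine ⟨n * β, α, hα0, hα1, fun k => ?_⟩
  have hdiag : ∀ i : Fin n, ∀ᵐ ℓ ∂μ, (lyap 𝔾 F)^[k] (fun _ => 1) ℓ i i ≤ β * α ^ k := by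
    intro i
    have hm := memH_lyap_iterate hac hF (memH_const (μ := μ) 1) k
    have := ae_le_of_forall_probability_lintegral_le (μ := μ)
      (f := fun ℓ => ENNReal.ofReal ((lyap 𝔾 F)^[k] (fun _ => 1) ℓ i i))
      (c := ENNReal.ofReal (β * α ^ k)) (hm.1 i i).ennreal_ofReal fun μ₀ hμ₀ hμ₀μ => by
        have h1 := h (EuclideanSpace.single i 1) μ₀ hμ₀ hμ₀μ k
        rw [lintegral_norm_sq_state hac hF] at h1
        simpa using h1
    filter_upwards [this] with ℓ hℓ
    exact (ENNReal.ofReal_le_ofReal_iff (by positivity)).1 hℓ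
  filter_upwards [ae_all_iff.2 hdiag, lyap_iterate_nonneg hac hF (memH_const 1)
    (Eventually.of_forall fun _ => one_nonneg_matrix) k] with ℓ h1 h2
  rw [mul_assoc]
  exact le_smul_one_of_apply_self_le h2 h1

/-- The partial sums `∑_{j<k} 𝓣_F^j(I)`. -/
noncomputable def lyapSum (𝔾 : Kernel Θ Θ) (F : Θ → Matrix (Fin n) (Fin n) ℝ) :
    ℕ → Θ → Matrix (Fin n) (Fin n) ℝ
  | 0 => fun _ => 0
  | k + 1 => fun ℓ => 1 + lyap 𝔾 F (lyapSum 𝔾 F k) ℓ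

theorem memH_lyapSum (hac : ∀ ℓ, 𝔾 ℓ ≪ μ) {F : Θ → Matrix (Fin n) (Fin n) ℝ} (hF : MemH μ F) :
    ∀ k, MemH μ (lyapSum 𝔾 F k)
  | 0 => memH_const 0
  | k + 1 => (memH_const 1).add (memH_lyap hac hF (memH_lyapSum hac hF k))

theorem lyapSum_nonneg (hac : ∀ ℓ, 𝔾 ℓ ≪ μ) {F : Θ → Matrix (Fin n) (Fin n) ℝ} (hF : MemH μ F) :
    ∀ k ℓ, 0 ≤ lyapSum 𝔾 F k ℓ
  | 0, _ => le_rfl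
  | k + 1, ℓ => add_nonneg one_nonneg_matrix (lyap_nonneg hac (memH_lyapSum hac hF k)
      (Eventually.of_forall (lyapSum_nonneg hac hF k)) F ℓ)

/-- The definition splits off the zeroth term of the sum; here the last one is split off. -/
theorem lyapSum_succ (hac : ∀ ℓ, 𝔾 ℓ ≪ μ) {F : Θ → Matrix (Fin n) (Fin n) ℝ} (hF : MemH μ F) :
    ∀ k, lyapSum 𝔾 F (k + 1) = fun ℓ => lyapSum 𝔾 F k ℓ + (lyap 𝔾 F)^[k] (fun _ => 1) ℓ
  | 0 => by
    ext1 ℓ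
    have : kernE 𝔾 (fun _ => (0 : Matrix (Fin n) (Fin n) ℝ)) ℓ = 0 := by ext; simp [kernE]
    simp [lyapSum, lyap, this]
  | k + 1 => by
    ext1 ℓ
    change 1 + lyap 𝔾 F (lyapSum 𝔾 F (k + 1)) ℓ = _
    conv_lhs => rw [lyapSum_succ hac hF k, lyap_add hac (memH_lyapSum hac hF k)
      (memH_lyap_iterate hac hF (memH_const 1) k), ← add_assoc]
    rw [Function.iterate_succ_apply']
    rfl

/-- A finite sum suffices. If `Z = ∑_{j≤N} T_F^j(1)` and `T_F^{N+1}(1) ≤ 1/2`, telescoping gives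
`T_F(Z) ≤ Z - 1/2`, and `Z ≤ d` turns this into the factor `1 - 1/(2d)`. -/
theorem EMSS.exists_isLyapunov [SigmaFinite μ] (hac : ∀ ℓ, 𝔾 ℓ ≪ μ)
    {F : Θ → Matrix (Fin n) (Fin n) ℝ} (hF : MemH μ F) (h : EMSS μ 𝔾 F) :
    ∃ Z c ρ, IsLyapunov μ 𝔾 F Z c ρ := by
  obtain ⟨β, α, hα0, hα1, hk⟩ := h.lyap_iterate_le hac hF
  obtain ⟨N, hN⟩ : ∃ N : ℕ, β * α ^ (N + 1) ≤ 1 / 2 := by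
    have ht : Tendsto (fun k : ℕ => β * α ^ (k + 1)) atTop (nhds 0) := by
      simpa using ((tendsto_pow_atTop_nhds_zero_of_lt_one hα0.le hα1).comp
        (tendsto_add_atTop_nat 1)).const_mul β
    exact (ht.eventually (ge_mem_nhds (by norm_num : (0 : ℝ) < 1 / 2))).exists
  have hZ := memH_lyapSum hac hF (N + 1)
  have hZ0 := lyapSum_nonneg hac hF (N + 1)
  obtain ⟨c, -, hc⟩ := hZ.le_smul_one (Eventually.of_forall fun ℓ => isSymm_of_nonneg (hZ0 ℓ))
  -- Enlarging the bound to at least `1` keeps the decay factor `1 - 1/(2d)` positive.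
  have hc' : ∀ᵐ ℓ ∂μ, lyapSum 𝔾 F (N + 1) ℓ ≤ max c 1 • 1 := by
    filter_upwards [hc] with ℓ hℓ
    exact hℓ.trans (smul_le_smul_of_le one_nonneg_matrix (le_max_left _ _))
  have hd : 1 ≤ max c 1 := le_max_right _ _
  generalize max c 1 = d at hc' hd
  refine ⟨lyapSum 𝔾 F (N + 1), d, 1 - 1 / 2 * d⁻¹, hZ, hd, ?_, ?_, ?_, hc', ?_⟩
  · have := inv_le_one_of_one_le₀ hd
    linarith
  · have : 0 < d⁻¹ := by positivity
    linarith
  · refine Eventually.of_forall fun ℓ => ?_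
    exact le_add_of_nonneg_right (lyap_nonneg hac (memH_lyapSum hac hF N)
      (Eventually.of_forall (lyapSum_nonneg hac hF N)) F ℓ)
  · filter_upwards [hc', hk (N + 1)] with ℓ h1 h2
    have e1 : lyap 𝔾 F (lyapSum 𝔾 F (N + 1)) ℓ =
        lyapSum 𝔾 F (N + 1) ℓ + (lyap 𝔾 F)^[N + 1] (fun _ => 1) ℓ - 1 := by
      have := congrFun (lyapSum_succ hac hF (N + 1)) ℓ
      rw [lyapSum] at this
      exact eq_sub_of_add_eq ((add_comm _ _).trans this)
    have h3 := h2.trans (smul_le_smul_of_le one_nonneg_matrix hN)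
    have h4 : d⁻¹ • lyapSum 𝔾 F (N + 1) ℓ ≤ 1 := by
      have := smul_le_smul_matrix (inv_nonneg.2 (zero_le_one.trans hd)) h1
      rwa [smul_smul, inv_mul_cancel₀ (by positivity), one_smul] at this
    have h5 := smul_le_smul_matrix (by norm_num : (0 : ℝ) ≤ 1 / 2) h4
    rw [e1, sub_smul, mul_smul, one_smul]
    calc _ ≤ lyapSum 𝔾 F (N + 1) ℓ + (1 / 2 : ℝ) • 1 - 1 := by gcongr
      _ = lyapSum 𝔾 F (N + 1) ℓ - (1 / 2 : ℝ) • 1 := by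
        have : (1 : Matrix (Fin n) (Fin n) ℝ) = (1 / 2 : ℝ) • 1 + (1 / 2 : ℝ) • 1 := by
          rw [← add_smul]; norm_num
        nth_rewrite 2 [this]
        abel
      _ ≤ _ := by gcongr

/-- Comparison principle: bounded supersolutions of the Lyapunov equation are nonnegative. -/
theorem IsLyapunov.nonneg_of_lyap_le (hac : ∀ ℓ, 𝔾 ℓ ≪ μ)
    {F Z D : Θ → Matrix (Fin n) (Fin n) ℝ} {c ρ : ℝ} (h : IsLyapunov μ 𝔾 F Z c ρ)
    (hD : MemH μ D) (hDs : ∀ᵐ ℓ ∂μ, (D ℓ).IsSymm) (hle : ∀ᵐ ℓ ∂μ, lyap 𝔾 F D ℓ ≤ D ℓ) :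
    ∀ᵐ ℓ ∂μ, 0 ≤ D ℓ := by
  obtain ⟨d, hd0, hd⟩ := hD.neg.le_smul_one (hDs.mono fun ℓ hℓ => hℓ.neg)
  -- Boundedness gives `D ≥ -d Z`; applying `T_F` repeatedly improves this to `D ≥ -d ρ^k Z`, and `k
  -- → ∞` finishes.
  have hk : ∀ k : ℕ, ∀ᵐ ℓ ∂μ, (-(d * ρ ^ k)) • Z ℓ ≤ D ℓ := by
    intro k
    induction k with
    | zero =>
      filter_upwards [hd, h.one_le] with ℓ h1 h2
      have := h1.trans (smul_le_smul_matrix hd0.le h2)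
      rw [pow_zero, mul_one, neg_smul]
      exact neg_le.1 this
    | succ k ih =>
      filter_upwards [hle, h.lyap_le] with ℓ h1 h2
      refine le_trans ?_ ((lyap_mono hac (h.memH.smul _) hD ih F ℓ).trans h1)
      rw [lyap_smul, neg_smul, neg_smul, neg_le_neg_iff, pow_succ, ← mul_assoc, mul_smul _ ρ]
      exact smul_le_smul_matrix (mul_nonneg hd0.le (pow_nonneg h.rho_pos.le k)) h2
  filter_upwards [ae_all_iff.2 hk, hDs] with ℓ h1 h2
  refine nonneg_iff_quadForm.2 ⟨h2, fun x => ?_⟩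
  have ht : Tendsto (fun k : ℕ => -(d * ρ ^ k) * (x ⬝ᵥ Z ℓ *ᵥ x)) atTop (nhds 0) := by
    simpa using (((tendsto_pow_atTop_nhds_zero_of_lt_one h.rho_pos.le
      h.rho_lt_one).const_mul d).neg).mul_const (x ⬝ᵥ Z ℓ *ᵥ x)
  refine le_of_tendsto ht (Eventually.of_forall fun k => ?_)
  have := quadForm_mono (h1 k) x
  rwa [Matrix.smul_mulVec, dotProduct_smul, smul_eq_mul] at this

end Lyapunov

/-! ### The Riccati operator -/

section RiccatiOperator

variable {Θ : Type*} [MeasurableSpace Θ] {μ : Measure Θ} {n m : ℕ} {𝔾 : Kernel Θ Θ}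

/-- `R + Gᵀ 𝓔(P) G`, the average being taken along the kernel. -/
noncomputable def ricR (𝔾 : Kernel Θ Θ) (G : Θ → Matrix (Fin n) (Fin m) ℝ)
    (R : Θ → Matrix (Fin m) (Fin m) ℝ) (P : Θ → Matrix (Fin n) (Fin n) ℝ) :
    Θ → Matrix (Fin m) (Fin m) ℝ :=
  fun ℓ => R ℓ + (G ℓ)ᵀ * kernE 𝔾 P ℓ * G ℓ

/-- `Gᵀ 𝓔(P) A`, the average being taken along the kernel. -/
noncomputable def ricG (𝔾 : Kernel Θ Θ) (A : Θ → Matrix (Fin n) (Fin n) ℝ)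
    (G : Θ → Matrix (Fin n) (Fin m) ℝ) (P : Θ → Matrix (Fin n) (Fin n) ℝ) :
    Θ → Matrix (Fin m) (Fin n) ℝ :=
  fun ℓ => (G ℓ)ᵀ * kernE 𝔾 P ℓ * A ℓ

/-- The feedback gain attached to `P`. -/
noncomputable def ricM (𝔾 : Kernel Θ Θ) (A : Θ → Matrix (Fin n) (Fin n) ℝ)
    (G : Θ → Matrix (Fin n) (Fin m) ℝ) (R : Θ → Matrix (Fin m) (Fin m) ℝ)
    (P : Θ → Matrix (Fin n) (Fin n) ℝ) : Θ → Matrix (Fin m) (Fin n) ℝ :=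
  fun ℓ => -((ricR 𝔾 G R P ℓ)⁻¹ * ricG 𝔾 A G P ℓ)

/-- The Riccati operator, the average being taken along the kernel. -/
noncomputable def ric (𝔾 : Kernel Θ Θ) (A : Θ → Matrix (Fin n) (Fin n) ℝ)
    (G : Θ → Matrix (Fin n) (Fin m) ℝ) (Q : Θ → Matrix (Fin n) (Fin n) ℝ)
    (R : Θ → Matrix (Fin m) (Fin m) ℝ) (P : Θ → Matrix (Fin n) (Fin n) ℝ) :
    Θ → Matrix (Fin n) (Fin n) ℝ :=
  fun ℓ => lyap 𝔾 A P ℓ + Q ℓ - (ricG 𝔾 A G P ℓ)ᵀ * (ricR 𝔾 G R P ℓ)⁻¹ * ricG 𝔾 A G P ℓ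

/-- The closed loop matrix `A + G K`. -/
def closedLoop (A : Θ → Matrix (Fin n) (Fin n) ℝ) (G : Θ → Matrix (Fin n) (Fin m) ℝ)
    (K : Θ → Matrix (Fin m) (Fin n) ℝ) : Θ → Matrix (Fin n) (Fin n) ℝ :=
  fun ℓ => A ℓ + G ℓ * K ℓ

/-- The running cost `Q + Kᵀ R K`. -/
def runningCost (Q : Θ → Matrix (Fin n) (Fin n) ℝ) (R : Θ → Matrix (Fin m) (Fin m) ℝ)
    (K : Θ → Matrix (Fin m) (Fin n) ℝ) : Θ → Matrix (Fin n) (Fin n) ℝ :=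
  fun ℓ => Q ℓ + (K ℓ)ᵀ * R ℓ * K ℓ

variable {A Q P P' : Θ → Matrix (Fin n) (Fin n) ℝ} {G : Θ → Matrix (Fin n) (Fin m) ℝ}
  {R : Θ → Matrix (Fin m) (Fin m) ℝ}

/-- The left side is the cost of one step under `K` with terminal weight `P`. Where `ricR` is
nonnegative, `ricM` is thus an optimal gain. -/
theorem lyap_closedLoop_add_runningCost {ℓ : Θ} (hP : (kernE 𝔾 P ℓ).IsSymm) (hR : (R ℓ).IsSymm)
    (hu : IsUnit (ricR 𝔾 G R P ℓ)) (K : Θ → Matrix (Fin m) (Fin n) ℝ) :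
    lyap 𝔾 (closedLoop A G K) P ℓ + runningCost Q R K ℓ = ric 𝔾 A G Q R P ℓ +
      (K ℓ - ricM 𝔾 A G R P ℓ)ᵀ * ricR 𝔾 G R P ℓ * (K ℓ - ricM 𝔾 A G R P ℓ) := by
  have h := riccati_completion hP hR (A ℓ) (G ℓ) hu (K ℓ)
  simp only [lyap, closedLoop, runningCost, ric, ricM, ricR, ricG]
  rw [add_left_comm, h]
  abel

theorem ric_eq_lyap_closedLoop {ℓ : Θ} (hP : (kernE 𝔾 P ℓ).IsSymm) (hR : (R ℓ).IsSymm)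
    (hu : IsUnit (ricR 𝔾 G R P ℓ)) :
    ric 𝔾 A G Q R P ℓ = lyap 𝔾 (closedLoop A G (ricM 𝔾 A G R P)) P ℓ +
      runningCost Q R (ricM 𝔾 A G R P) ℓ := by
  simp [lyap_closedLoop_add_runningCost hP hR hu]

theorem ric_le_lyap_closedLoop {ℓ : Θ} (hP : (kernE 𝔾 P ℓ).IsSymm) (hR : (R ℓ).IsSymm)
    (hu : IsUnit (ricR 𝔾 G R P ℓ)) (h0 : 0 ≤ ricR 𝔾 G R P ℓ) (K : Θ → Matrix (Fin m) (Fin n) ℝ) :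
    ric 𝔾 A G Q R P ℓ ≤ lyap 𝔾 (closedLoop A G K) P ℓ + runningCost Q R K ℓ := by
  rw [lyap_closedLoop_add_runningCost hP hR hu]
  exact le_add_of_nonneg_right (conj_nonneg h0 _)

theorem memH_closedLoop {K : Θ → Matrix (Fin m) (Fin n) ℝ} (hA : MemH μ A) (hG : MemH μ G)
    (hK : MemH μ K) : MemH μ (closedLoop A G K) :=
  hA.add (hG.mul hK)

theorem memH_runningCost {K : Θ → Matrix (Fin m) (Fin n) ℝ} (hQ : MemH μ Q) (hR : MemH μ R)
    (hK : MemH μ K) : MemH μ (runningCost Q R K) :=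
  hQ.add ((hK.transpose.mul hR).mul hK)

theorem runningCost_nonneg {X : Type*} {Q : X → Matrix (Fin n) (Fin n) ℝ}
    {R : X → Matrix (Fin m) (Fin m) ℝ} {ℓ : X} (hQ : 0 ≤ Q ℓ) (hR : 0 ≤ R ℓ)
    (K : X → Matrix (Fin m) (Fin n) ℝ) : 0 ≤ runningCost Q R K ℓ :=
  add_nonneg hQ (conj_nonneg hR _)

theorem ric_isSymm (hP : ∀ ℓ, (P ℓ).IsSymm) (hQ : ∀ ℓ, (Q ℓ).IsSymm) (hR : ∀ ℓ, (R ℓ).IsSymm)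
    (ℓ : Θ) : (ric 𝔾 A G Q R P ℓ).IsSymm := by
  have h1 : (ricR 𝔾 G R P ℓ).IsSymm := (hR ℓ).add (isSymm_conj (kernE_isSymm hP ℓ) _)
  have h2 : ((ricR 𝔾 G R P ℓ)⁻¹).IsSymm := by
    rw [Matrix.IsSymm, Matrix.transpose_nonsing_inv, h1.eq]
  exact ((lyap_isSymm hP A ℓ).add (hQ ℓ)).sub (isSymm_conj h2 _)

theorem measurable_ricR_apply (hG : MemH μ G) (hR : MemH μ R)
    (hP : ∀ i j, Measurable fun ℓ => P ℓ i j) (i j : Fin m) :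
    Measurable fun ℓ => ricR 𝔾 G R P ℓ i j :=
  (hR.1 i j).add (measurable_mul_apply
    (measurable_mul_apply (fun i j => hG.1 j i) (measurable_kernE_apply hP)) hG.1 i j)

theorem measurable_ricG_apply (hA : MemH μ A) (hG : MemH μ G)
    (hP : ∀ i j, Measurable fun ℓ => P ℓ i j) (i : Fin m) (j : Fin n) :
    Measurable fun ℓ => ricG 𝔾 A G P ℓ i j :=
  measurable_mul_apply
    (measurable_mul_apply (fun i j => hG.1 j i) (measurable_kernE_apply hP)) hA.1 i j

theorem measurable_ricM_apply (hA : MemH μ A) (hG : MemH μ G) (hR : MemH μ R)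
    (hP : ∀ i j, Measurable fun ℓ => P ℓ i j) (i : Fin m) (j : Fin n) :
    Measurable fun ℓ => ricM 𝔾 A G R P ℓ i j :=
  (measurable_mul_apply (measurable_inv_apply (measurable_ricR_apply hG hR hP))
    (measurable_ricG_apply hA hG hP) i j).neg

theorem measurable_ric_apply (hA : MemH μ A) (hG : MemH μ G) (hQ : MemH μ Q) (hR : MemH μ R)
    (hP : ∀ i j, Measurable fun ℓ => P ℓ i j) (i j : Fin n) :
    Measurable fun ℓ => ric 𝔾 A G Q R P ℓ i j :=
  ((measurable_mul_apply
    (measurable_mul_apply (fun i j => hA.1 j i) (measurable_kernE_apply hP)) hA.1 i j).add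
      (hQ.1 i j)).sub (measurable_mul_apply (measurable_mul_apply
        (fun i j => measurable_ricG_apply hA hG hP j i)
        (measurable_inv_apply (measurable_ricR_apply hG hR hP)))
        (measurable_ricG_apply hA hG hP) i j)

variable [IsMarkovKernel 𝔾]

theorem smul_one_le_ricR (hac : ∀ ℓ, 𝔾 ℓ ≪ μ) (hP : MemH μ P) (hP0 : ∀ᵐ ℓ ∂μ, 0 ≤ P ℓ) {ξ : ℝ}
    {ℓ : Θ} (hR : ξ • 1 ≤ R ℓ) : ξ • 1 ≤ ricR 𝔾 G R P ℓ :=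
  hR.trans (le_add_of_nonneg_right (conj_nonneg (kernE_nonneg hac hP hP0 ℓ) _))

/-- The Riccati operator is monotone on nonnegative arguments. -/
theorem ric_mono (hac : ∀ ℓ, 𝔾 ℓ ≪ μ) (hP : MemH μ P) (hP0 : ∀ᵐ ℓ ∂μ, 0 ≤ P ℓ)
    (hP' : MemH μ P') (h : ∀ᵐ ℓ ∂μ, P ℓ ≤ P' ℓ) {ξ : ℝ} (hξ : 0 < ξ) {ℓ : Θ}
    (hR : ξ • 1 ≤ R ℓ) : ric 𝔾 A G Q R P ℓ ≤ ric 𝔾 A G Q R P' ℓ := by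
  have hP0' : ∀ᵐ ℓ ∂μ, 0 ≤ P' ℓ := by
    filter_upwards [hP0, h] with ℓ h1 h2 using h1.trans h2
  have hs := isSymm_of_nonneg (kernE_nonneg hac hP hP0 ℓ)
  have hs' := isSymm_of_nonneg (kernE_nonneg hac hP' hP0' ℓ)
  have hξ1 : (0 : Matrix (Fin m) (Fin m) ℝ) ≤ ξ • 1 := by
    simpa using smul_le_smul_matrix hξ.le (one_nonneg_matrix (n := m))
  have hRs := isSymm_of_nonneg (hξ1.trans hR)
  have h1 := smul_one_le_ricR (G := G) hac hP hP0 hR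
  have h1' := smul_one_le_ricR (G := G) hac hP' hP0' hR
  -- The gain of `P'` is optimal for `P'` but merely admissible for `P`.
  rw [ric_eq_lyap_closedLoop hs' hRs (isUnit_of_smul_one_le hξ h1')]
  refine (ric_le_lyap_closedLoop hs hRs (isUnit_of_smul_one_le hξ h1) (hξ1.trans h1)
    (ricM 𝔾 A G R P')).trans ?_
  gcongr
  exact lyap_mono hac hP hP' h _ ℓ

theorem exists_runningCost_le_smul_one {K : Θ → Matrix (Fin m) (Fin n) ℝ} (hQ : MemH μ Q)
    (hR : MemH μ R) (hK : MemH μ K) (h0 : ∀ᵐ ℓ ∂μ, 0 ≤ Q ℓ) (h0' : ∀ᵐ ℓ ∂μ, 0 ≤ R ℓ) :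
    ∃ c : ℝ, 0 < c ∧ ∀ᵐ ℓ ∂μ, runningCost Q R K ℓ ≤ c • 1 :=
  (memH_runningCost hQ hR hK).le_smul_one (by
    filter_upwards [h0, h0'] with ℓ h1 h2
    exact isSymm_of_nonneg (runningCost_nonneg h1 h2 K))

/-- In closed-loop form the equation reads `P = T_F(P) +` running cost, so `P` is a supersolution.
Only invertibility of `ricR` enters, not its sign; hence uniqueness needs no sign condition. -/
theorem nonneg_of_riccati_of_emss [SigmaFinite μ] (hac : ∀ ℓ, 𝔾 ℓ ≪ μ) (hA : MemH μ A)
    (hG : MemH μ G) (hQ0 : ∀ᵐ ℓ ∂μ, 0 ≤ Q ℓ) (hR0 : ∀ᵐ ℓ ∂μ, 0 ≤ R ℓ) (hP : MemSH μ P)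
    (hsol : ∀ᵐ ℓ ∂μ, IsUnit (ricR 𝔾 G R P ℓ) ∧ P ℓ = ric 𝔾 A G Q R P ℓ)
    (hM : MemH μ (ricM 𝔾 A G R P)) (hst : EMSS μ 𝔾 (closedLoop A G (ricM 𝔾 A G R P))) :
    ∀ᵐ ℓ ∂μ, 0 ≤ P ℓ := by
  obtain ⟨Z, c, ρ, hZ⟩ := hst.exists_isLyapunov hac (memH_closedLoop hA hG hM)
  refine hZ.nonneg_of_lyap_le hac hP.1 (Eventually.of_forall hP.2) ?_
  filter_upwards [hsol, hQ0, hR0] with ℓ h1 h2 h3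
  conv_rhs => rw [h1.2, ric_eq_lyap_closedLoop (kernE_isSymm hP.2 ℓ) (isSymm_of_nonneg h3) h1.1]
  exact le_add_of_nonneg_right (runningCost_nonneg h2 h3 _)

/-- A nonnegative solution of the Riccati equation lies below every solution with a stable closed
loop. -/
theorem le_of_riccati_of_emss [SigmaFinite μ] (hac : ∀ ℓ, 𝔾 ℓ ≪ μ) (hA : MemH μ A)
    (hG : MemH μ G) (hR0 : ∀ᵐ ℓ ∂μ, 0 ≤ R ℓ) (hP : MemSH μ P)
    (hP0 : ∀ᵐ ℓ ∂μ, 0 ≤ P ℓ) (hP' : MemSH μ P')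
    (hsol : ∀ᵐ ℓ ∂μ, IsUnit (ricR 𝔾 G R P ℓ) ∧ P ℓ = ric 𝔾 A G Q R P ℓ)
    (hsol' : ∀ᵐ ℓ ∂μ, IsUnit (ricR 𝔾 G R P' ℓ) ∧ P' ℓ = ric 𝔾 A G Q R P' ℓ)
    (hM' : MemH μ (ricM 𝔾 A G R P')) (hst' : EMSS μ 𝔾 (closedLoop A G (ricM 𝔾 A G R P'))) :
    ∀ᵐ ℓ ∂μ, P ℓ ≤ P' ℓ := by
  obtain ⟨Z, c, ρ, hZ⟩ := hst'.exists_isLyapunov hac (memH_closedLoop hA hG hM')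
  have := hZ.nonneg_of_lyap_le hac (hP'.1.sub hP.1)
    (Eventually.of_forall fun ℓ => (hP'.2 ℓ).sub (hP.2 ℓ)) (by
      filter_upwards [hsol, hsol', hR0] with ℓ h1 h2 h3
      rw [lyap_sub hac hP'.1 hP.1]
      -- At the gain of `P'`, the solution `P'` gives an equality and `P` only an inequality, as
      -- `ricR` at `P` is nonnegative. In the difference the running costs cancel.
      have e := ric_eq_lyap_closedLoop (A := A) (Q := Q) (kernE_isSymm hP'.2 ℓ)
        (isSymm_of_nonneg h3) h2.1
      have h4 : 0 ≤ ricR 𝔾 G R P ℓ :=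
        add_nonneg h3 (conj_nonneg (kernE_nonneg hac hP.1 hP0 ℓ) _)
      have l := ric_le_lyap_closedLoop (A := A) (Q := Q) (kernE_isSymm hP.2 ℓ)
        (isSymm_of_nonneg h3) h1.1 h4 (ricM 𝔾 A G R P')
      rw [← h1.2] at l
      rw [← h2.2] at e
      conv_rhs => rw [e]
      have := sub_le_sub_left l (lyap 𝔾 (closedLoop A G (ricM 𝔾 A G R P')) P' ℓ +
        runningCost Q R (ricM 𝔾 A G R P') ℓ)
      rwa [add_sub_add_right_eq_sub] at this)
  filter_upwards [this] with ℓ hℓ using sub_nonneg.1 hℓ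

end RiccatiOperator

/-! ### Limits of matrix sequences -/

section Limits

variable {n : ℕ}

/-- A bounded monotone sequence of symmetric matrices converges entrywise. -/
theorem exists_tendsto_apply_of_monotone {U : ℕ → Matrix (Fin n) (Fin n) ℝ} {c : ℝ}
    (hs : ∀ k, (U k).IsSymm) (hmono : ∀ k, U k ≤ U (k + 1)) (hc : ∀ k, U k ≤ c • 1)
    (i j : Fin n) : ∃ a, Tendsto (fun k => U k i j) atTop (nhds a) := by
  have hq : ∀ x : Fin n → ℝ, ∃ a, Tendsto (fun k => x ⬝ᵥ U k *ᵥ x) atTop (nhds a) := fun x =>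
    ⟨_, tendsto_atTop_ciSup (monotone_nat_of_le_succ fun k => quadForm_mono (hmono k) x)
      ⟨x ⬝ᵥ (c • (1 : Matrix (Fin n) (Fin n) ℝ)) *ᵥ x, by
        rintro _ ⟨k, rfl⟩
        exact quadForm_mono (hc k) x⟩⟩
  -- The forms at `e_i + e_j` and `e_i - e_j` differ by four times the `(i, j)` entry.
  obtain ⟨a, ha⟩ := hq (Pi.single i 1 + (1 : ℝ) • Pi.single j 1)
  obtain ⟨b, hb⟩ := hq (Pi.single i 1 + (-1 : ℝ) • Pi.single j 1)
  refine ⟨(a - b) / 4, ((ha.sub hb).div_const 4).congr fun k => ?_⟩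
  rw [quadForm_single_add_smul_single (hs k), quadForm_single_add_smul_single (hs k)]
  ring

theorem tendsto_matrix_inv {U : ℕ → Matrix (Fin n) (Fin n) ℝ} {V : Matrix (Fin n) (Fin n) ℝ}
    (h : Tendsto U atTop (nhds V)) (hV : IsUnit V) :
    Tendsto (fun k => (U k)⁻¹) atTop (nhds V⁻¹) := by
  simp only [Matrix.nonsing_inv_eq_ringInverse]
  obtain ⟨u, rfl⟩ := hV
  exact (NormedRing.inverse_continuousAt u).tendsto.comp h

theorem tendsto_conj {m p : ℕ} {X : ℕ → Matrix (Fin n) (Fin n) ℝ} {Y : Matrix (Fin n) (Fin n) ℝ}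
    (h : Tendsto X atTop (nhds Y)) (B : Matrix (Fin m) (Fin n) ℝ) (C : Matrix (Fin n) (Fin p) ℝ) :
    Tendsto (fun k => B * X k * C) atTop (nhds (B * Y * C)) := by
  have : Continuous fun X : Matrix (Fin n) (Fin n) ℝ => B * X * C := by fun_prop
  exact (this.tendsto Y).comp h

theorem tendsto_riccati {m : ℕ} {X : ℕ → Matrix (Fin n) (Fin n) ℝ} {Y : Matrix (Fin n) (Fin n) ℝ}
    (h : Tendsto X atTop (nhds Y)) (A Q : Matrix (Fin n) (Fin n) ℝ) (G : Matrix (Fin n) (Fin m) ℝ)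
    (R : Matrix (Fin m) (Fin m) ℝ) (hu : IsUnit (R + Gᵀ * Y * G)) :
    Tendsto (fun k => Aᵀ * X k * A + Q -
        (Gᵀ * X k * A)ᵀ * (R + Gᵀ * X k * G)⁻¹ * (Gᵀ * X k * A)) atTop
      (nhds (Aᵀ * Y * A + Q - (Gᵀ * Y * A)ᵀ * (R + Gᵀ * Y * G)⁻¹ * (Gᵀ * Y * A))) := by
  have hS : Tendsto (fun k => R + Gᵀ * X k * G) atTop (nhds (R + Gᵀ * Y * G)) :=
    tendsto_const_nhds.add (tendsto_conj h Gᵀ G)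
  have hL := tendsto_conj h Gᵀ A
  have hinv := tendsto_matrix_inv hS hu
  have hcont : Continuous fun z : Matrix (Fin m) (Fin n) ℝ × Matrix (Fin m) (Fin m) ℝ =>
      z.1ᵀ * z.2 * z.1 :=
    (continuous_fst.matrix_transpose.matrix_mul continuous_snd).matrix_mul continuous_fst
  have hquad := (hcont.tendsto (Gᵀ * Y * A, (R + Gᵀ * Y * G)⁻¹)).comp (hL.prodMk_nhds hinv)
  exact ((tendsto_conj h Aᵀ A).add tendsto_const_nhds).sub hquad

end Limits

/-! ### Value iteration -/

section ValueIteration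

variable {Θ : Type*} [MeasurableSpace Θ] {μ : Measure Θ} {n m : ℕ} {𝔾 : Kernel Θ Θ}
  {A Q : Θ → Matrix (Fin n) (Fin n) ℝ} {G : Θ → Matrix (Fin n) (Fin m) ℝ}
  {R : Θ → Matrix (Fin m) (Fin m) ℝ}

/-- Value iteration: the iterates of the Riccati operator, started at zero. -/
noncomputable def valueIter (𝔾 : Kernel Θ Θ) (A : Θ → Matrix (Fin n) (Fin n) ℝ)
    (G : Θ → Matrix (Fin n) (Fin m) ℝ) (Q : Θ → Matrix (Fin n) (Fin n) ℝ)
    (R : Θ → Matrix (Fin m) (Fin m) ℝ) (k : ℕ) : Θ → Matrix (Fin n) (Fin n) ℝ :=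
  (ric 𝔾 A G Q R)^[k] fun _ => 0

theorem valueIter_succ (k : ℕ) :
    valueIter 𝔾 A G Q R (k + 1) = ric 𝔾 A G Q R (valueIter 𝔾 A G Q R k) := by
  simp only [valueIter, Function.iterate_succ_apply']

theorem measurable_valueIter_apply (hA : MemH μ A) (hG : MemH μ G) (hQ : MemH μ Q)
    (hR : MemH μ R) (k : ℕ) : ∀ i j, Measurable fun ℓ => valueIter 𝔾 A G Q R k ℓ i j := by
  induction k with
  | zero => exact fun i j => measurable_const
  | succ k ih => rw [valueIter_succ]; exact measurable_ric_apply hA hG hQ hR ih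

theorem valueIter_isSymm (hQ : ∀ ℓ, (Q ℓ).IsSymm) (hR : ∀ ℓ, (R ℓ).IsSymm) (k : ℕ) :
    ∀ ℓ, (valueIter 𝔾 A G Q R k ℓ).IsSymm := by
  induction k with
  | zero => exact fun ℓ => Matrix.isSymm_zero
  | succ k ih => rw [valueIter_succ]; exact ric_isSymm ih hQ hR

theorem tendsto_ric {U : ℕ → Θ → Matrix (Fin n) (Fin n) ℝ} {V : Θ → Matrix (Fin n) (Fin n) ℝ}
    {ℓ : Θ} (h : Tendsto (fun k => kernE 𝔾 (U k) ℓ) atTop (nhds (kernE 𝔾 V ℓ)))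
    (hu : IsUnit (ricR 𝔾 G R V ℓ)) :
    Tendsto (fun k => ric 𝔾 A G Q R (U k) ℓ) atTop (nhds (ric 𝔾 A G Q R V ℓ)) :=
  tendsto_riccati h (A ℓ) (Q ℓ) (G ℓ) (R ℓ) hu

variable [IsMarkovKernel 𝔾]

/-- The bound propagates because the fixed gain `K` costs at least the minimum: one step from `b Z`
yields at most `b ρ Z + (1 - ρ) b Z = b Z`. -/
theorem valueIter_bounds (hac : ∀ ℓ, 𝔾 ℓ ≪ μ) (hA : MemH μ A) (hG : MemH μ G)
    (hQ : MemH μ Q) (hQ0 : ∀ᵐ ℓ ∂μ, 0 ≤ Q ℓ) (hR : MemH μ R) {ξ : ℝ} (hξ : 0 < ξ)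
    (hRξ : ∀ᵐ ℓ ∂μ, ξ • 1 ≤ R ℓ) {K : Θ → Matrix (Fin m) (Fin n) ℝ}
    {Z : Θ → Matrix (Fin n) (Fin n) ℝ} {c ρ b : ℝ} (hZ : IsLyapunov μ 𝔾 (closedLoop A G K) Z c ρ)
    (hb : 0 ≤ b) (hK : ∀ᵐ ℓ ∂μ, runningCost Q R K ℓ ≤ ((1 - ρ) * b) • Z ℓ) (k : ℕ) :
    MemH μ (valueIter 𝔾 A G Q R k) ∧ (∀ᵐ ℓ ∂μ, 0 ≤ valueIter 𝔾 A G Q R k ℓ) ∧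
      ∀ᵐ ℓ ∂μ, valueIter 𝔾 A G Q R k ℓ ≤ b • Z ℓ := by
  have hξ1 : (0 : Matrix (Fin m) (Fin m) ℝ) ≤ ξ • 1 := by
    simpa using smul_le_smul_matrix hξ.le (one_nonneg_matrix (n := m))
  induction k with
  | zero =>
    refine ⟨memH_const 0, Eventually.of_forall fun _ => le_rfl, ?_⟩
    filter_upwards [hZ.nonneg] with ℓ hℓ
    have := smul_le_smul_matrix hb hℓ
    rwa [smul_zero] at this
  | succ k ih =>
    obtain ⟨h1, h2, h3⟩ := ih
    have hs := fun ℓ => isSymm_of_nonneg (kernE_nonneg hac h1 h2 ℓ)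
    have h0 : ∀ᵐ ℓ ∂μ, 0 ≤ valueIter 𝔾 A G Q R (k + 1) ℓ := by
      filter_upwards [hQ0, hRξ] with ℓ q r
      rw [valueIter_succ, ric_eq_lyap_closedLoop (hs ℓ) (isSymm_of_nonneg (hξ1.trans r))
        (isUnit_of_smul_one_le hξ (smul_one_le_ricR hac h1 h2 r))]
      exact add_nonneg (lyap_nonneg hac h1 h2 _ ℓ) (runningCost_nonneg q (hξ1.trans r) _)
    have hle : ∀ᵐ ℓ ∂μ, valueIter 𝔾 A G Q R (k + 1) ℓ ≤ b • Z ℓ := by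
      filter_upwards [hRξ, hK, hZ.lyap_le] with ℓ r hKℓ hZℓ
      have hr := smul_one_le_ricR (G := G) hac h1 h2 r
      rw [valueIter_succ]
      calc _ ≤ _ := ric_le_lyap_closedLoop (hs ℓ) (isSymm_of_nonneg (hξ1.trans r))
              (isUnit_of_smul_one_le hξ hr) (hξ1.trans hr) K
        _ ≤ lyap 𝔾 (closedLoop A G K) (fun t => b • Z t) ℓ + ((1 - ρ) * b) • Z ℓ :=
            add_le_add (lyap_mono hac h1 (hZ.memH.smul b) h3 _ ℓ) hKℓ
        _ ≤ b • ρ • Z ℓ + ((1 - ρ) * b) • Z ℓ := by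
            rw [lyap_smul]
            exact add_le_add (smul_le_smul_matrix hb hZℓ) le_rfl
        _ = b • Z ℓ := by
            rw [smul_smul, ← add_smul]
            congr 1
            ring
    refine ⟨memH_of_nonneg_of_le (c := b * c) (measurable_valueIter_apply hA hG hQ hR _) h0 ?_,
      h0, hle⟩
    filter_upwards [hle, hZ.le_smul_one] with ℓ u v
    rw [mul_smul]
    exact u.trans (smul_le_smul_matrix hb v)

theorem tendsto_kernE (hac : ∀ ℓ, 𝔾 ℓ ≪ μ) {U : ℕ → Θ → Matrix (Fin n) (Fin n) ℝ}
    {V : Θ → Matrix (Fin n) (Fin n) ℝ} (hU : ∀ k i j, Measurable fun ℓ => U k ℓ i j) {c : ℝ}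
    (hc : ∀ᵐ ℓ ∂μ, ∀ k i j, |U k ℓ i j| ≤ c)
    (h : ∀ᵐ ℓ ∂μ, ∀ i j, Tendsto (fun k => U k ℓ i j) atTop (nhds (V ℓ i j))) (ℓ : Θ) :
    Tendsto (fun k => kernE 𝔾 (U k) ℓ) atTop (nhds (kernE 𝔾 V ℓ)) := by
  refine tendsto_pi_nhds.2 fun i => tendsto_pi_nhds.2 fun j => ?_
  refine tendsto_integral_of_dominated_convergence (fun _ => c)
    (fun k => (hU k i j).aestronglyMeasurable) (integrable_const c) (fun k => ?_) ?_
  · filter_upwards [(hac ℓ).ae_le hc] with t ht using ht k i j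
  · filter_upwards [(hac ℓ).ae_le h] with t ht using ht i j

/-- Stabilizability gives a nonnegative bounded solution of the Riccati equation. -/
theorem exists_nonneg_riccati_solution [SigmaFinite μ] (hac : ∀ ℓ, 𝔾 ℓ ≪ μ) (hA : MemH μ A)
    (hG : MemH μ G) (hQ : MemSH μ Q) (hQ0 : ∀ᵐ ℓ ∂μ, 0 ≤ Q ℓ) (hR : MemSH μ R) {ξ : ℝ}
    (hξ : 0 < ξ) (hRξ : ∀ᵐ ℓ ∂μ, ξ • 1 ≤ R ℓ) (hst : Stabilizable μ 𝔾 A G) :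
    ∃ P, MemSH μ P ∧ (∀ᵐ ℓ ∂μ, 0 ≤ P ℓ) ∧ ∀ᵐ ℓ ∂μ, P ℓ = ric 𝔾 A G Q R P ℓ := by
  have hξ1 : (0 : Matrix (Fin m) (Fin m) ℝ) ≤ ξ • 1 := by
    simpa using smul_le_smul_matrix hξ.le (one_nonneg_matrix (n := m))
  obtain ⟨K, hK, hemss⟩ := hst
  obtain ⟨Z, c, ρ, hZ⟩ := EMSS.exists_isLyapunov hac (memH_closedLoop hA hG hK) hemss
  obtain ⟨d, hd0, hd⟩ := exists_runningCost_le_smul_one hQ.1 hR.1 hK hQ0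
    (hRξ.mono fun ℓ hℓ => hξ1.trans hℓ)
  have hρ : 0 < 1 - ρ := sub_pos.2 hZ.rho_lt_one
  -- With `b = d / (1 - ρ)`, the requirement of `valueIter_bounds` becomes running cost `≤ d Z`,
  -- which follows from `Z ≥ 1`.
  have hb : 0 ≤ d / (1 - ρ) := by positivity
  have hbounds := valueIter_bounds hac hA hG hQ.1 hQ0 hR.1 hξ hRξ hZ hb (by
    filter_upwards [hd, hZ.one_le] with ℓ h1 h2
    rw [mul_div_cancel₀ _ hρ.ne']
    exact h1.trans (smul_le_smul_matrix hd0.le h2))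
  generalize d / (1 - ρ) = b at hb hbounds
  have hmono : ∀ k, ∀ᵐ ℓ ∂μ, valueIter 𝔾 A G Q R k ℓ ≤ valueIter 𝔾 A G Q R (k + 1) ℓ := by
    intro k
    induction k with
    | zero => exact (hbounds 1).2.1
    | succ k ih =>
      filter_upwards [hRξ] with ℓ r
      rw [valueIter_succ, valueIter_succ (k + 1)]
      exact ric_mono hac (hbounds k).1 (hbounds k).2.1 (hbounds (k + 1)).1 ih hξ r
  have hle : ∀ᵐ ℓ ∂μ, ∀ k, valueIter 𝔾 A G Q R k ℓ ≤ (b * c) • 1 := by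
    refine ae_all_iff.2 fun k => ?_
    filter_upwards [(hbounds k).2.2, hZ.le_smul_one] with ℓ u v
    rw [mul_smul]
    exact u.trans (smul_le_smul_matrix hb v)
  have h0 : ∀ᵐ ℓ ∂μ, ∀ k, 0 ≤ valueIter 𝔾 A G Q R k ℓ := ae_all_iff.2 fun k => (hbounds k).2.1
  have hsymm := valueIter_isSymm (𝔾 := 𝔾) (A := A) (G := G) hQ.2 hR.2
  have hmeas := measurable_valueIter_apply (𝔾 := 𝔾) hA hG hQ.1 hR.1
  -- The entrywise `limsup` is measurable and symmetric at every `ℓ`, and equals the limit almost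
  -- everywhere.
  set P : Θ → Matrix (Fin n) (Fin n) ℝ := fun ℓ => Matrix.of fun i j =>
    limsup (fun k => valueIter 𝔾 A G Q R k ℓ i j) atTop with hP
  have htend : ∀ᵐ ℓ ∂μ, ∀ i j,
      Tendsto (fun k => valueIter 𝔾 A G Q R k ℓ i j) atTop (nhds (P ℓ i j)) := by
    filter_upwards [ae_all_iff.2 hmono, hle] with ℓ h1 h2 i j
    obtain ⟨a, ha⟩ := exists_tendsto_apply_of_monotone (fun k => hsymm k ℓ) h1 h2 i j
    simpa only [hP, Matrix.of_apply, ha.limsup_eq] using ha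
  have htend' : ∀ᵐ ℓ ∂μ, Tendsto (fun k => valueIter 𝔾 A G Q R k ℓ) atTop (nhds (P ℓ)) := by
    filter_upwards [htend] with ℓ hℓ
    exact tendsto_pi_nhds.2 fun i => tendsto_pi_nhds.2 fun j => hℓ i j
  have habs : ∀ᵐ ℓ ∂μ, ∀ k i j, |valueIter 𝔾 A G Q R k ℓ i j| ≤ b * c := by
    filter_upwards [h0, hle] with ℓ h1 h2 k i j
    exact abs_apply_le_of_le_smul_one (h1 k) (h2 k) i j
  have hPH : MemH μ P := by
    refine memH_of_abs_apply_le (c := b * c)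
      (fun i j => Measurable.limsup fun k => hmeas k i j) ?_
    filter_upwards [htend, habs] with ℓ h1 h2 i j
    exact le_of_tendsto (h1 i j).abs (Eventually.of_forall fun k => h2 k i j)
  have hP0 : ∀ᵐ ℓ ∂μ, 0 ≤ P ℓ := by
    filter_upwards [htend', h0] with ℓ h1 h2
    exact isClosed_nonneg.mem_of_tendsto h1 (Eventually.of_forall h2)
  refine ⟨P, ⟨hPH, fun ℓ => ?_⟩, hP0, ?_⟩
  · ext i j
    simp only [hP, Matrix.transpose_apply, Matrix.of_apply]
    congr 1
    ext1 k
    exact (hsymm k ℓ).apply i j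
  · filter_upwards [htend', hRξ] with ℓ h1 r
    -- Dominated convergence passes the limit through the average; `ricR` at `P` is at least `ξ`, so
    -- inversion is continuous there.
    have h2 := tendsto_ric (A := A) (Q := Q) (tendsto_kernE hac hmeas habs htend ℓ)
      (isUnit_of_smul_one_le hξ (smul_one_le_ricR (G := G) hac hPH hP0 r))
    simp only [← valueIter_succ] at h2
    exact tendsto_nhds_unique ((tendsto_add_atTop_iff_nat 1).2 h1) h2

end ValueIteration

/-! ### Detectability -/

section Detectability

variable {Θ : Type*} [MeasurableSpace Θ] {μ : Measure Θ} {n m p : ℕ} {𝔾 : Kernel Θ Θ}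
  [IsMarkovKernel 𝔾] {A Q P : Θ → Matrix (Fin n) (Fin n) ℝ} {G : Θ → Matrix (Fin n) (Fin m) ℝ}
  {R : Θ → Matrix (Fin m) (Fin m) ℝ}

theorem transpose_mul_mul_le {g : ℝ} {B : Matrix (Fin n) (Fin m) ℝ} (hB : ‖B‖ ≤ g)
    (M : Matrix (Fin m) (Fin p) ℝ) : (B * M)ᵀ * (B * M) ≤ g ^ 2 • (Mᵀ * M) := by
  have := conj_mono (transpose_mul_self_le hB) M
  simpa [Matrix.transpose_mul, Matrix.mul_assoc] using this

theorem transpose_sub_mul_sub_le (U V : Matrix (Fin n) (Fin m) ℝ) :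
    (U - V)ᵀ * (U - V) ≤ (2 : ℝ) • (Uᵀ * U) + (2 : ℝ) • (Vᵀ * V) := by
  have := conj_add_le one_nonneg_matrix one_ne_zero U (-V)
  norm_num at this
  simpa [sub_eq_add_neg] using this

/-- Under detectability, a feedback whose cost has a bounded nonnegative value function is
stabilizing. -/
theorem emss_of_detectable [SigmaFinite μ] (hac : ∀ ℓ, 𝔾 ℓ ≪ μ) (hA : MemH μ A)
    (hG : MemH μ G) {C : Θ → Matrix (Fin p) (Fin n) ℝ} (hC : MemH μ C)
    (hCQ : ∀ᵐ ℓ ∂μ, (C ℓ)ᵀ * C ℓ ≤ Q ℓ) {ξ : ℝ} (hξ : 0 < ξ) (hRξ : ∀ᵐ ℓ ∂μ, ξ • 1 ≤ R ℓ)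
    (hdet : Detectable μ 𝔾 A C) (hP : MemH μ P) (hP0 : ∀ᵐ ℓ ∂μ, 0 ≤ P ℓ)
    {M : Θ → Matrix (Fin m) (Fin n) ℝ} (hM : MemH μ M)
    (hle : ∀ᵐ ℓ ∂μ, lyap 𝔾 (closedLoop A G M) P ℓ + runningCost Q R M ℓ ≤ P ℓ) :
    EMSS μ 𝔾 (closedLoop A G M) := by
  obtain ⟨H, hH, hemss⟩ := hdet
  obtain ⟨Y, c, ρ, hY⟩ := EMSS.exists_isLyapunov hac (hA.add (hH.mul hC)) hemss
  obtain ⟨γ, -, hγ⟩ := hG.exists_norm_le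
  obtain ⟨η, -, hη⟩ := hH.exists_norm_le
  obtain ⟨d, -, hd⟩ := hP.le_smul_one (hP0.mono fun ℓ hℓ => isSymm_of_nonneg hℓ)
  have hρ0 := hY.rho_pos
  have hρ1 := hY.rho_lt_one
  have hc1 := hY.one_le_c
  -- The Young weight is chosen so that the stable part `A + HC` still contracts, now with factor
  -- `(1 + ρ)/2`.
  obtain ⟨a, ha0, ha⟩ : ∃ a : ℝ, a ≠ 0 ∧ (1 + a ^ 2) * ρ = (1 + ρ) / 2 := by
    have hpos : 0 < (1 - ρ) / (2 * ρ) := div_pos (sub_pos.2 hρ1) (by positivity)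
    refine ⟨√((1 - ρ) / (2 * ρ)), (Real.sqrt_pos.2 hpos).ne', ?_⟩
    rw [Real.sq_sqrt hpos.le]
    field_simp
    ring
  obtain ⟨κ, hκ⟩ : ∃ κ, κ = (1 + a⁻¹ ^ 2) * (c * (2 * (γ ^ 2 / ξ) + 2 * η ^ 2)) := ⟨_, rfl⟩
  have hκ0 : 0 ≤ κ := by rw [hκ]; positivity
  -- The closed loop is `A + HC` plus `W = GM - HC`. Since `R ≥ ξ` and `CᵀC ≤ Q`, `WᵀW` is at most a
  -- multiple of the running cost, which is in turn bounded by the decrease of `P`.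
  have hY' : ∀ᵐ ℓ ∂μ, lyap 𝔾 (closedLoop A G M) Y ℓ ≤
      ((1 + ρ) / 2) • Y ℓ + κ • (P ℓ - lyap 𝔾 (closedLoop A G M) P ℓ) := by
    filter_upwards [hY.lyap_le, hγ, hη, hCQ, hRξ, hle] with ℓ h1 h2 h3 h4 h5 h6
    have hE0 := kernE_nonneg hac hY.memH hY.nonneg ℓ
    have hEc : kernE 𝔾 Y ℓ ≤ c • 1 := by
      refine (kernE_mono hac hY.memH (memH_const (c • 1)) hY.le_smul_one ℓ).trans_eq ?_
      ext i j
      simp [kernE]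
    set W := G ℓ * M ℓ - H ℓ * C ℓ with hW
    have hF : closedLoop A G M ℓ = (A ℓ + H ℓ * C ℓ) + W := by
      simp only [closedLoop, hW]
      abel
    have hMR : (M ℓ)ᵀ * M ℓ ≤ ξ⁻¹ • ((M ℓ)ᵀ * R ℓ * M ℓ) := by
      have := smul_le_smul_matrix (inv_nonneg.2 hξ.le) (conj_mono h5 (M ℓ))
      simpa [smul_smul, hξ.ne'] using this
    have hq0 : 0 ≤ Q ℓ := (transpose_mul_self_nonneg _).trans h4
    have hr0 : 0 ≤ (M ℓ)ᵀ * R ℓ * M ℓ := by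
      refine conj_nonneg (le_trans ?_ h5) _
      simpa using smul_le_smul_matrix hξ.le (one_nonneg_matrix (n := m))
    have hWW : Wᵀ * W ≤ (2 * (γ ^ 2 / ξ) + 2 * η ^ 2) • runningCost Q R M ℓ := by
      calc Wᵀ * W ≤ (2 : ℝ) • ((G ℓ * M ℓ)ᵀ * (G ℓ * M ℓ)) +
            (2 : ℝ) • ((H ℓ * C ℓ)ᵀ * (H ℓ * C ℓ)) := transpose_sub_mul_sub_le _ _
        _ ≤ (2 : ℝ) • (γ ^ 2 • ξ⁻¹ • ((M ℓ)ᵀ * R ℓ * M ℓ)) + (2 : ℝ) • (η ^ 2 • Q ℓ) := by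
          refine add_le_add (smul_le_smul_matrix two_pos.le ?_)
            (smul_le_smul_matrix two_pos.le ?_)
          · exact (transpose_mul_mul_le h2 _).trans (smul_le_smul_matrix (sq_nonneg γ) hMR)
          · exact (transpose_mul_mul_le h3 _).trans (smul_le_smul_matrix (sq_nonneg η) h4)
        _ = (2 * (γ ^ 2 / ξ)) • ((M ℓ)ᵀ * R ℓ * M ℓ) + (2 * η ^ 2) • Q ℓ := by
          simp only [smul_smul, div_eq_mul_inv]
        _ ≤ (2 * (γ ^ 2 / ξ) + 2 * η ^ 2) • ((M ℓ)ᵀ * R ℓ * M ℓ) +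
            (2 * (γ ^ 2 / ξ) + 2 * η ^ 2) • Q ℓ := by
          refine add_le_add (smul_le_smul_of_le hr0 ?_) (smul_le_smul_of_le hq0 ?_)
          · exact le_add_of_nonneg_right (by positivity)
          · exact le_add_of_nonneg_left (by positivity)
        _ = _ := by rw [← smul_add, runningCost, add_comm (Q ℓ)]
    have hWE : Wᵀ * kernE 𝔾 Y ℓ * W ≤
        (c * (2 * (γ ^ 2 / ξ) + 2 * η ^ 2)) • runningCost Q R M ℓ := by
      refine (conj_mono hEc W).trans ?_
      rw [mul_smul]
      simpa using smul_le_smul_matrix (zero_le_one.trans hc1) hWW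
    have h7 : runningCost Q R M ℓ ≤ P ℓ - lyap 𝔾 (closedLoop A G M) P ℓ :=
      le_sub_iff_add_le'.2 h6
    calc lyap 𝔾 (closedLoop A G M) Y ℓ
        ≤ (1 + a ^ 2) • lyap 𝔾 (fun ℓ => A ℓ + H ℓ * C ℓ) Y ℓ +
          (1 + a⁻¹ ^ 2) • (Wᵀ * kernE 𝔾 Y ℓ * W) := by
          rw [lyap, hF]
          exact conj_add_le hE0 ha0 _ _
      _ ≤ (1 + a ^ 2) • ρ • Y ℓ + (1 + a⁻¹ ^ 2) •
          ((c * (2 * (γ ^ 2 / ξ) + 2 * η ^ 2)) • runningCost Q R M ℓ) :=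
          add_le_add (smul_le_smul_matrix (by positivity) h1)
            (smul_le_smul_matrix (by positivity) hWE)
      _ = ((1 + ρ) / 2) • Y ℓ + κ • runningCost Q R M ℓ := by
          rw [smul_smul, smul_smul, ha, hκ]
      _ ≤ _ := add_le_add le_rfl (smul_le_smul_matrix hκ0 h7)
  -- The Lyapunov function is `Y + κ P`, with upper bound `c'`. The terms `κ T_F(P)` cancel, leaving
  -- the decrease `((1 - ρ)/2) Y`, and `Y ≥ 1 ≥ c'⁻¹ (Y + κ P)` converts it into a decay factor.
  set c' := c + κ * max d 0 with hc'
  have hκd : 0 ≤ κ * max d 0 := mul_nonneg hκ0 (le_max_right _ _)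
  have hc'1 : 1 ≤ c' := by linarith
  have hc'0 : 0 < c' := by linarith
  have hinv : c'⁻¹ ≤ 1 := inv_le_one_of_one_le₀ hc'1
  have hinv0 : 0 < c'⁻¹ := inv_pos.2 hc'0
  have hZle : ∀ᵐ ℓ ∂μ, Y ℓ + κ • P ℓ ≤ c' • 1 := by
    filter_upwards [hY.le_smul_one, hd] with ℓ h1 h2
    rw [hc', add_smul, mul_smul]
    refine add_le_add h1 (smul_le_smul_matrix hκ0 (h2.trans ?_))
    exact smul_le_smul_of_le one_nonneg_matrix (le_max_left _ _)
  refine IsLyapunov.emss (Z := fun ℓ => Y ℓ + κ • P ℓ) (c := c')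
    (ρ := 1 - (1 - ρ) / 2 * c'⁻¹) hac (memH_closedLoop hA hG hM)
    ⟨hY.memH.add (hP.smul κ), hc'1, ?_, ?_, ?_, hZle, ?_⟩
  · nlinarith
  · have : 0 < (1 - ρ) / 2 * c'⁻¹ := mul_pos (by linarith) hinv0
    linarith
  · filter_upwards [hY.one_le, hP0] with ℓ h1 h2
    refine h1.trans (le_add_of_nonneg_right ?_)
    simpa using smul_le_smul_matrix hκ0 h2
  · filter_upwards [hY', hZle, hY.one_le] with ℓ h1 h2 h3
    have h4 : c'⁻¹ • (Y ℓ + κ • P ℓ) ≤ Y ℓ := by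
      refine le_trans ?_ h3
      have := smul_le_smul_matrix hinv0.le h2
      rwa [smul_smul, inv_mul_cancel₀ hc'0.ne', one_smul] at this
    have h5 := smul_le_smul_matrix (by linarith : (0 : ℝ) ≤ (1 - ρ) / 2) h4
    rw [lyap_add hac hY.memH (hP.smul κ), lyap_smul, sub_smul, one_smul, mul_smul]
    calc _ ≤ ((1 + ρ) / 2) • Y ℓ + κ • (P ℓ - lyap 𝔾 (closedLoop A G M) P ℓ) +
            κ • lyap 𝔾 (closedLoop A G M) P ℓ := add_le_add h1 le_rfl
      _ = Y ℓ + κ • P ℓ - ((1 - ρ) / 2) • Y ℓ := by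
          rw [smul_sub]
          have : Y ℓ = ((1 + ρ) / 2) • Y ℓ + ((1 - ρ) / 2) • Y ℓ := by
            rw [← add_smul, ← add_div]; norm_num
          nth_rewrite 2 [this]
          abel
      _ ≤ _ := sub_le_sub_left h5 _

/-- All terms of the closed-loop form of the equation are nonnegative, so `ξ MᵀM ≤ MᵀRM ≤ P ≤ d`. -/
theorem memH_ricM (hac : ∀ ℓ, 𝔾 ℓ ≪ μ) (hA : MemH μ A) (hG : MemH μ G) (hR : MemH μ R) {ξ : ℝ}
    (hξ : 0 < ξ) (hRξ : ∀ᵐ ℓ ∂μ, ξ • 1 ≤ R ℓ) (hQ0 : ∀ᵐ ℓ ∂μ, 0 ≤ Q ℓ) (hP : MemH μ P)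
    (hP0 : ∀ᵐ ℓ ∂μ, 0 ≤ P ℓ) (hsol : ∀ᵐ ℓ ∂μ, P ℓ = ric 𝔾 A G Q R P ℓ) :
    MemH μ (ricM 𝔾 A G R P) := by
  obtain ⟨d, -, hd⟩ := hP.le_smul_one (hP0.mono fun ℓ hℓ => isSymm_of_nonneg hℓ)
  -- Each squared entry is at most `t = ξ⁻¹ d`, and `t ≤ (1 + t)²` avoids a square root.
  refine memH_of_abs_apply_le (c := 1 + ξ⁻¹ * d) (measurable_ricM_apply hA hG hR hP.1) ?_
  have hξ1 : (0 : Matrix (Fin m) (Fin m) ℝ) ≤ ξ • 1 := by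
    simpa using smul_le_smul_matrix hξ.le (one_nonneg_matrix (n := m))
  filter_upwards [hRξ, hd, hsol, hQ0] with ℓ h1 h2 h3 h4 i j
  have hs := isSymm_of_nonneg (kernE_nonneg hac hP hP0 ℓ)
  have e := ric_eq_lyap_closedLoop (A := A) (Q := Q) hs (isSymm_of_nonneg (hξ1.trans h1))
    (isUnit_of_smul_one_le hξ (smul_one_le_ricR (G := G) hac hP hP0 h1))
  rw [← h3] at e
  set M := ricM 𝔾 A G R P with hM
  have hMR : (M ℓ)ᵀ * R ℓ * M ℓ ≤ d • 1 := by
    refine le_trans ?_ h2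
    rw [e, runningCost, ← add_assoc]
    exact le_add_of_nonneg_left (add_nonneg (lyap_nonneg hac hP hP0 _ ℓ) h4)
  have hMM : (M ℓ)ᵀ * M ℓ ≤ (ξ⁻¹ * d) • 1 := by
    have := smul_le_smul_matrix (inv_nonneg.2 hξ.le) ((conj_mono h1 (M ℓ)).trans hMR)
    simpa [smul_smul, hξ.ne'] using this
  have hjj := abs_apply_le_of_le_smul_one (transpose_mul_self_nonneg _) hMM j j
  have hij : M ℓ i j ^ 2 ≤ ((M ℓ)ᵀ * M ℓ) j j := by
    rw [Matrix.mul_apply]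
    simp only [Matrix.transpose_apply, ← sq]
    exact Finset.single_le_sum (f := fun k => M ℓ k j ^ 2) (fun k _ => sq_nonneg _)
      (Finset.mem_univ i)
  have := (le_abs_self _).trans hjj
  refine abs_le_of_sq_le_sq (by nlinarith) ?_
  nlinarith [sq_nonneg (M ℓ i j)]

end Detectability

end MJLS

/-! ### The corollary -/

theorem corollary1 {Θ : Type*} [MeasurableSpace Θ] [StandardBorelSpace Θ]
    (μ : Measure Θ) [SigmaFinite μ]
    (𝔾 : Kernel Θ Θ) [IsMarkovKernel 𝔾]
    (g : Θ → Θ → ℝ) (hg_meas : ∀ ℓ, Measurable (g ℓ)) (hg_nonneg : ∀ ℓ t, 0 ≤ g ℓ t)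
    (hg : ∀ ℓ, 𝔾 ℓ = μ.withDensity fun t => ENNReal.ofReal (g ℓ t))
    {n m : ℕ}
    (A : Θ → Matrix (Fin n) (Fin n) ℝ) (hA : MJLS.MemH μ A)
    (G : Θ → Matrix (Fin n) (Fin m) ℝ) (hG : MJLS.MemH μ G)
    (Q : Θ → Matrix (Fin n) (Fin n) ℝ) (hQ : MJLS.MemHPos μ Q)
    (R : Θ → Matrix (Fin m) (Fin m) ℝ) (hR : MJLS.MemHPosStar μ R)
    (hstab : MJLS.Stabilizable μ 𝔾 A G)
    (hdet : MJLS.Detectable μ 𝔾 A (MJLS.sqrtFun Q)) :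
    ∃ P : Θ → Matrix (Fin n) (Fin n) ℝ,
      MJLS.IsStabilizingSolution μ 𝔾 g A G Q R P ∧ MJLS.SignCondition μ g G R P ∧
        ∀ P' : Θ → Matrix (Fin n) (Fin n) ℝ,
          MJLS.IsStabilizingSolution μ 𝔾 g A G Q R P' → P' =ᵐ[μ] P := by
  open MJLS in
  open scoped MatrixOrder in
  have hac : ∀ ℓ, 𝔾 ℓ ≪ μ := fun ℓ => hg ℓ ▸ withDensity_absolutelyContinuous _ _
  have hE := opE_eq_kernE (n := n) hg_meas hg_nonneg hg
  have hQ0 : ∀ᵐ ℓ ∂μ, 0 ≤ Q ℓ := hQ.2.mono fun ℓ hℓ => Matrix.nonneg_iff_posSemidef.2 hℓ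
  have hR0 : ∀ᵐ ℓ ∂μ, 0 ≤ R ℓ := hR.1.2.mono fun ℓ hℓ => Matrix.nonneg_iff_posSemidef.2 hℓ
  obtain ⟨ξ, hξ, hRξ⟩ := hR.2
  -- The Loewner order unfolds to positive semidefiniteness of the difference.
  have hRξ : ∀ᵐ ℓ ∂μ, ξ • 1 ≤ R ℓ := hRξ
  have hopR : ∀ P, opR μ g G R P = ricR 𝔾 G R P := fun P => by
    ext1 ℓ
    simp only [opR, opT, ricR, hE]
  have hopM : ∀ P, opM μ g A G R P = ricM 𝔾 A G R P := fun P => by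
    ext1 ℓ
    simp only [opM, opG, hopR, ricM, ricG, hE]
  have hsol_iff : ∀ P, IsSolution μ g A G Q R P ↔
      MemSH μ P ∧ ∀ᵐ ℓ ∂μ, IsUnit (ricR 𝔾 G R P ℓ) ∧ P ℓ = ric 𝔾 A G Q R P ℓ := fun P => by
    simp only [IsSolution, opG, opT, hopR, ric, ricG, lyap, hE]
  obtain ⟨P, hP, hP0, hric⟩ := exists_nonneg_riccati_solution hac hA hG hQ.1 hQ0 hR.1.1 hξ
    hRξ hstab
  have hRP : ∀ᵐ ℓ ∂μ, ξ • 1 ≤ ricR 𝔾 G R P ℓ := by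
    filter_upwards [hRξ] with ℓ h using smul_one_le_ricR hac hP.1 hP0 h
  have hsol : ∀ᵐ ℓ ∂μ, IsUnit (ricR 𝔾 G R P ℓ) ∧ P ℓ = ric 𝔾 A G Q R P ℓ := by
    filter_upwards [hRP, hric] with ℓ h1 h2 using ⟨isUnit_of_smul_one_le hξ h1, h2⟩
  have hM := memH_ricM hac hA hG hR.1.1.1 hξ hRξ hQ0 hP.1 hP0 hric
  have hemss : EMSS μ 𝔾 (closedLoop A G (ricM 𝔾 A G R P)) := by
    refine emss_of_detectable (Q := Q) hac hA hG (memH_sqrtFun hQ.1.1 hQ0)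
      (hQ0.mono fun ℓ hℓ => (sqrtFun_transpose_mul_self hℓ).le) hξ hRξ hdet hP.1 hP0 hM ?_
    filter_upwards [hsol] with ℓ h1
    conv_rhs => rw [h1.2, ric_eq_lyap_closedLoop (kernE_isSymm hP.2 ℓ) (hR.1.1.2 ℓ) h1.1]
  refine ⟨P, ⟨(hsol_iff P).2 ⟨hP, hsol⟩, ?_⟩, ⟨ξ, hξ, ?_⟩, fun P' h' => ?_⟩
  · rw [hopM]
    exact ⟨hM, hemss⟩
  · rw [hopR]
    exact hRP
  · obtain ⟨h1, h2⟩ := h'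
    obtain ⟨hP', hsol'⟩ := (hsol_iff P').1 h1
    rw [hopM] at h2
    -- Once `P' ≥ 0` is known, the roles of `P` and `P'` are symmetric and the comparison applies in
    -- both directions.
    have hP'0 := nonneg_of_riccati_of_emss hac hA hG hQ0 hR0 hP' hsol' h2.1 h2.2
    filter_upwards [le_of_riccati_of_emss hac hA hG hR0 hP hP0 hP' hsol hsol' h2.1 h2.2,
      le_of_riccati_of_emss hac hA hG hR0 hP' hP'0 hP hsol' hsol hM hemss] with ℓ l1 l2
    exact le_antisymm l2 l1
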